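/- Let $\mathbf S=(S(t))_{t\ge 0}$ be a strongly continuous semigroup on a complex Banach space $X$ with generator $A$. Fix $\lambda$ in the resolvent set $\rho(A)$ (which is nonempty), let $X_{-1}\supseteq X$ be the completion of $X$ with respect to the norm $\|(\lambda-A)^{-1}\cdot\|$, let $\mathbf S_{-1}$ be the unique extension of $\mathbf S$ to a strongly continuous semigroup on $X_{-1}$, and let $A_{-1}\colon X\to X_{-1}$ be its generator, a bounded operator from $X$ to $X_{-1}$ extending $A$. For $\tau>0$ let $\mathrm C([0,\tau],X)$ be the space of continuous functions and $\mathrm{Reg}([0,\tau],X)$ the space of regulated functions $f\colon[0,\tau]\to X$ (those with a right limit at every point of $[0,\tau)$ and a left limit at every point of $(0,\tau]$). For $\mathrm F\in\{\mathrm C,\mathrm{Reg}\}$: * $\mathbf S$ satisfies $\mathrm F$-maximal regularity if for some $\tau>0$ and all $f\in\mathrm F([0,\tau],X)$ the function $(\mathbf S*f)(t)=\int_0^t S(t-s)f(s)\,\mathrm ds$ satisfies $(\mathbf S*f)(t)\in D(A)$ for almost every $t\in(0,\tau)$ and $A(\mathbf S*f)\in\mathrm F([0,\tau],X)$, i.e.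 $A(\mathbf S*f)$ coincides almost everywhere on $(0,\tau)$ with an element of $\mathrm F([0,\tau],X)$; * $A_{-1}$ is $\mathrm F$-admissible if for some $\tau>0$ and all $u\in\mathrm F([0,\tau],X)$ one has $\int_0^\tau S_{-1}(\tau-t)A_{-1}u(t)\,\mathrm dt\in X$. Moreover, $\mathbf S$ is of bounded semivariation if for all $\tau>0$ $$\sup\Big\{\Big\|\sum_{i=1}^{n-1}(S(t_i)-S(t_{i+1}))x_i\Big\| : n\in\mathbb N,\ 0=t_1<t_2<\dots<t_n=\tau,\ x_i\in X,\ \|x_i\|\le 1\Big\}<\infty .$$ Then the following assertions are equivalent: 1. $\mathbf S$ satisfies $\mathrm C$-maximal regularity; 2. $A_{-1}$ is $\mathrm C$-admissible; 3. $\mathbf S$ is of bounded semivariation; 4. $\mathbf S$ satisfies $\mathrm{Reg}$-maximal regularity; 5. $A_{-1}$ is $\mathrm{Reg}$-admissible. -/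

import Mathlib

open Filter Topology MeasureTheory Set
open scoped NNReal ENNReal

/-- A strongly continuous semigroup `(S t)`, `t ≥ 0`, of bounded linear operators on the complex
normed space `X`. -/
structure C0Semigroup (X : Type*) [NormedAddCommGroup X] [NormedSpace ℂ X] where
  toFun : ℝ≥0 → X →L[ℂ] X
  map_zero' : toFun 0 = ContinuousLinearMap.id ℂ X
  map_add' : ∀ s t : ℝ≥0, toFun (s + t) = (toFun s).comp (toFun t)
  strongly_continuous : ∀ x : X, Continuous fun t => toFun t x

namespace C0Semigroup

instance {X : Type*} [NormedAddCommGroup X] [NormedSpace ℂ X] :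
    CoeFun (C0Semigroup X) (fun _ => ℝ≥0 → X →L[ℂ] X) := ⟨C0Semigroup.toFun⟩

/-- The difference quotient converges to `y` as `h → 0+`, that is, `x ∈ D(A)` and `A x = y`. -/
def HasGenerator {X : Type*} [NormedAddCommGroup X] [NormedSpace ℂ X] (S : C0Semigroup X)
    (x y : X) : Prop :=
  Tendsto (fun h : ℝ => (h : ℂ)⁻¹ • (S h.toNNReal x - x)) (𝓝[>] 0) (𝓝 y)

theorem HasGenerator.add {X : Type*} [NormedAddCommGroup X] [NormedSpace ℂ X]
    {S : C0Semigroup X} {x y x' y' : X} (h : S.HasGenerator x y) (h' : S.HasGenerator x' y') :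
    S.HasGenerator (x + x') (y + y') := by
  refine (Tendsto.add h h').congr fun r => ?_
  rw [← smul_add, map_add]
  congr 1
  abel

theorem HasGenerator.smul {X : Type*} [NormedAddCommGroup X] [NormedSpace ℂ X]
    {S : C0Semigroup X} {x y : X} (c : ℂ) (h : S.HasGenerator x y) :
    S.HasGenerator (c • x) (c • y) := by
  refine (Tendsto.const_smul h c).congr fun r => ?_
  rw [map_smul, ← smul_sub, smul_comm]

theorem HasGenerator.unique {X : Type*} [NormedAddCommGroup X] [NormedSpace ℂ X]
    {S : C0Semigroup X} {x y z : X} (h : S.HasGenerator x y) (h' : S.HasGenerator x z) : y = z :=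
  tendsto_nhds_unique h h'

/-- The (infinitesimal) generator `A` of the semigroup, an unbounded operator with domain
`D(A) = {x | lim_{h → 0+} (S h x - x) / h exists}`. -/
noncomputable def generator {X : Type*} [NormedAddCommGroup X] [NormedSpace ℂ X]
    (S : C0Semigroup X) : X →ₗ.[ℂ] X where
  domain :=
    { carrier := {x | ∃ y, S.HasGenerator x y}
      add_mem' := fun ⟨y, hy⟩ ⟨z, hz⟩ => ⟨y + z, hy.add hz⟩
      zero_mem' := ⟨0, by simp [HasGenerator]⟩
      smul_mem' := fun c _ ⟨y, hy⟩ => ⟨c • y, hy.smul c⟩ }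
  toFun :=
    { toFun := fun x => x.2.choose
      map_add' := fun x x' =>
        (x + x').2.choose_spec.unique (x.2.choose_spec.add x'.2.choose_spec)
      map_smul' := fun c x => (c • x).2.choose_spec.unique (x.2.choose_spec.smul c) }

theorem HasGenerator.mem_domain {X : Type*} [NormedAddCommGroup X] [NormedSpace ℂ X]
    {S : C0Semigroup X} {x y : X} (h : S.HasGenerator x y) : x ∈ S.generator.domain := ⟨y, h⟩

theorem hasGenerator_generator {X : Type*} [NormedAddCommGroup X] [NormedSpace ℂ X]
    (S : C0Semigroup X) (x : S.generator.domain) : S.HasGenerator x (S.generator x) :=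
  x.2.choose_spec

/-- `R` is a bounded two-sided inverse of `lam - A : D(A) → X`. -/
def IsResolventAt {X : Type*} [NormedAddCommGroup X] [NormedSpace ℂ X]
    (S : C0Semigroup X) (lam : ℂ) (R : X →L[ℂ] X) : Prop :=
  (∀ x : X, ∃ h : R x ∈ S.generator.domain, lam • R x - S.generator ⟨R x, h⟩ = x) ∧
    ∀ x : S.generator.domain, R (lam • (x : X) - S.generator x) = x

/-- The resolvent set `ρ(A)` of the generator. -/
def resolventSet {X : Type*} [NormedAddCommGroup X] [NormedSpace ℂ X]
    (S : C0Semigroup X) : Set ℂ :=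
  {lam | ∃ R : X →L[ℂ] X, S.IsResolventAt lam R}

/-- The resolvent `R(lam, A) = (lam - A)⁻¹`. -/
noncomputable def resolvent {X : Type*} [NormedAddCommGroup X] [NormedSpace ℂ X]
    (S : C0Semigroup X) (lam : S.resolventSet) : X →L[ℂ] X :=
  lam.2.choose

theorem resolvent_spec {X : Type*} [NormedAddCommGroup X] [NormedSpace ℂ X]
    (S : C0Semigroup X) (lam : S.resolventSet) : S.IsResolventAt lam (S.resolvent lam) :=
  lam.2.choose_spec

theorem resolvent_injective {X : Type*} [NormedAddCommGroup X] [NormedSpace ℂ X]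
    (S : C0Semigroup X) (lam : S.resolventSet) : Function.Injective (S.resolvent lam) := by
  refine (injective_iff_map_eq_zero _).2 fun x hx => ?_
  obtain ⟨h, e⟩ := (S.resolvent_spec lam).1 x
  have h0 : (⟨S.resolvent lam x, h⟩ : S.generator.domain) = 0 := Subtype.ext hx
  rw [h0, LinearPMap.map_zero, hx] at e
  simpa using e.symm

theorem hasGenerator_resolvent {X : Type*} [NormedAddCommGroup X] [NormedSpace ℂ X]
    (S : C0Semigroup X) (lam : S.resolventSet) (x : X) :
    S.HasGenerator (S.resolvent lam x) ((lam : ℂ) • S.resolvent lam x - x) := by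
  obtain ⟨h, e⟩ := (S.resolvent_spec lam).1 x
  have := S.hasGenerator_generator ⟨_, h⟩
  rwa [← sub_eq_iff_eq_add.2 (sub_eq_iff_eq_add'.1 e), ] at this

theorem commute {X : Type*} [NormedAddCommGroup X] [NormedSpace ℂ X]
    (S : C0Semigroup X) (s t : ℝ≥0) (x : X) : S s (S t x) = S t (S s x) := by
  rw [← ContinuousLinearMap.comp_apply, ← S.map_add', add_comm, S.map_add',
    ContinuousLinearMap.comp_apply]

theorem HasGenerator.map {X : Type*} [NormedAddCommGroup X] [NormedSpace ℂ X]
    {S : C0Semigroup X} {x y : X} (L : X →L[ℂ] X) (hL : ∀ t x, L (S t x) = S t (L x))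
    (h : S.HasGenerator x y) : S.HasGenerator (L x) (L y) := by
  refine ((L.continuous.tendsto y).comp h).congr fun r => ?_
  simp [hL]

theorem resolvent_commute {X : Type*} [NormedAddCommGroup X] [NormedSpace ℂ X]
    (S : C0Semigroup X) (lam : S.resolventSet) (t : ℝ≥0) (x : X) :
    S.resolvent lam (S t x) = S t (S.resolvent lam x) := by
  have h := (S.hasGenerator_resolvent lam x).map (S t) (fun s x => S.commute t s x)
  have e := (S.resolvent_spec lam).2 ⟨_, h.mem_domain⟩
  rw [(S.hasGenerator_generator ⟨_, h.mem_domain⟩).unique h] at e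
  simpa using e

/-- `X` with the norm `‖R(lam, A) x‖`. -/
def PreExtrapolation {X : Type*} [NormedAddCommGroup X] [NormedSpace ℂ X]
    (S : C0Semigroup X) (_lam : S.resolventSet) : Type _ := X

section instances

variable {X : Type*} [NormedAddCommGroup X] [NormedSpace ℂ X]
  (S : C0Semigroup X) (lam : S.resolventSet)

instance : AddCommGroup (PreExtrapolation S lam) := inferInstanceAs (AddCommGroup X)

instance : Module ℂ (PreExtrapolation S lam) := inferInstanceAs (Module ℂ X)

/-- The resolvent as a map on the renormed space. -/
noncomputable def preResolvent : PreExtrapolation S lam →ₗ[ℂ] X :=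
  (S.resolvent lam : X →ₗ[ℂ] X)

noncomputable instance : NormedAddCommGroup (PreExtrapolation S lam) :=
  NormedAddCommGroup.induced (PreExtrapolation S lam) X (preResolvent S lam)
    (S.resolvent_injective lam)

noncomputable instance : NormedSpace ℂ (PreExtrapolation S lam) :=
  NormedSpace.induced ℂ (PreExtrapolation S lam) X (preResolvent S lam)

/-- The extrapolation space `X₋₁`: the completion of `X` with respect to `‖R(lam, A) x‖`. -/
def Extrapolation : Type _ := UniformSpace.Completion (PreExtrapolation S lam)

noncomputable instance : NormedAddCommGroup (Extrapolation S lam) :=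
  inferInstanceAs (NormedAddCommGroup (UniformSpace.Completion (PreExtrapolation S lam)))

noncomputable instance : NormedSpace ℂ (Extrapolation S lam) :=
  inferInstanceAs (NormedSpace ℂ (UniformSpace.Completion (PreExtrapolation S lam)))

instance : CompleteSpace (Extrapolation S lam) :=
  inferInstanceAs (CompleteSpace (UniformSpace.Completion (PreExtrapolation S lam)))

end instances

/-- The canonical inclusion `X → X₋₁`. -/
noncomputable def toExtrapolation {X : Type*} [NormedAddCommGroup X] [NormedSpace ℂ X]
    (S : C0Semigroup X) (lam : S.resolventSet) : X →L[ℂ] Extrapolation S lam :=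
  LinearMap.mkContinuous
    ((UniformSpace.Completion.toComplL (𝕜 := ℂ) (E := PreExtrapolation S lam)).toLinearMap :
      X →ₗ[ℂ] Extrapolation S lam)
    ‖S.resolvent lam‖
    (fun x => (UniformSpace.Completion.norm_coe (E := PreExtrapolation S lam) x).trans_le
      ((S.resolvent lam).le_opNorm x))

theorem norm_toExtrapolation {X : Type*} [NormedAddCommGroup X] [NormedSpace ℂ X]
    (S : C0Semigroup X) (lam : S.resolventSet) (x : X) :
    ‖S.toExtrapolation lam x‖ = ‖S.resolvent lam x‖ :=
  UniformSpace.Completion.norm_coe (E := PreExtrapolation S lam) x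

theorem denseRange_toExtrapolation {X : Type*} [NormedAddCommGroup X] [NormedSpace ℂ X]
    (S : C0Semigroup X) (lam : S.resolventSet) : DenseRange (S.toExtrapolation lam) :=
  UniformSpace.Completion.denseRange_coe (α := PreExtrapolation S lam)

theorem exists_norm_le {X : Type*} [NormedAddCommGroup X] [NormedSpace ℂ X] [CompleteSpace X]
    (S : C0Semigroup X) (T : ℝ≥0) : ∃ C : ℝ, 0 ≤ C ∧ ∀ t ≤ T, ‖S t‖ ≤ C := by
  have h : ∀ x : X, ∃ C, ∀ t : Set.Iic T, ‖S t x‖ ≤ C := fun x => by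
    have hc : IsCompact (Set.Iic T) := by
      rw [← Set.Icc_bot]; exact isCompact_Icc
    obtain ⟨C, hC⟩ := hc.exists_bound_of_continuousOn (S.strongly_continuous x).continuousOn
    exact ⟨C, fun t => hC t t.2⟩
  obtain ⟨C, hC⟩ := banach_steinhaus (𝕜 := ℂ) (𝕜₂ := ℂ) (σ₁₂ := RingHom.id ℂ)
    (g := fun t : Set.Iic T => S t) h
  exact ⟨C, (norm_nonneg _).trans (hC ⟨0, Set.mem_Iic.2 zero_le⟩), fun t ht => hC ⟨t, ht⟩⟩

/-- The resolvent set of a generator is nonempty, so that extrapolation spaces exist. -/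
theorem resolventSet_nonempty {X : Type*} [NormedAddCommGroup X] [NormedSpace ℂ X]
    [CompleteSpace X] (S : C0Semigroup X) : S.resolventSet.Nonempty := by
  obtain ⟨C, hC0, hC⟩ := S.exists_norm_le 1
  -- the rescaled semigroup
  let l : ℝ := C + 1
  have hl : 0 < l := by positivity
  let e : ℝ → ℂ := fun s => Complex.exp (-(l * s : ℝ))
  have he : Continuous e := by fun_prop
  let T : ℝ → X →L[ℂ] X := fun s => e s • S s.toNNReal
  have hT : ∀ x, Continuous fun s => T s x := fun x =>
    he.smul ((S.strongly_continuous x).comp continuous_real_toNNReal)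
  have hadd : ∀ r s : ℝ, 0 ≤ r → 0 ≤ s → ∀ x, T r (T s x) = T (r + s) x := fun r s hr hs x => by
    simp only [T, e, Real.toNNReal_add hr hs, S.map_add', smul_apply,
      map_smul, smul_smul, ContinuousLinearMap.comp_apply, ← Complex.exp_add]
    congr 2
    push_cast
    ring
  have hne : ∀ s : ℝ, ‖e s‖ = Real.exp (-(l * s)) := fun s => by
    simp only [e, Complex.norm_exp]; simp
  have hTn : ∀ s ∈ Set.uIoc (0 : ℝ) 1, ∀ x, ‖T s x‖ ≤ C * ‖x‖ := fun s hs x => by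
    rw [Set.uIoc_of_le zero_le_one] at hs
    simp only [T, smul_apply, norm_smul, hne]
    have h1 : Real.exp (-(l * s)) ≤ 1 := Real.exp_le_one_iff.2 (by nlinarith [hs.1])
    have h2 := (S s.toNNReal).le_of_opNorm_le (hC _ (by simpa using hs.2)) x
    nlinarith [norm_nonneg (S s.toNNReal x), Real.exp_pos (-(l * s))]
  let R : X →L[ℂ] X := LinearMap.mkContinuous
    { toFun := fun x => ∫ s in (0 : ℝ)..1, T s x
      map_add' := fun x y => by
        simp only [_root_.map_add]
        exact intervalIntegral.integral_add ((hT x).intervalIntegrable _ _)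
          ((hT y).intervalIntegrable _ _)
      map_smul' := fun c x => by
        simp only [map_smul]
        exact intervalIntegral.integral_smul _ _ } C
    (fun x => (intervalIntegral.norm_integral_le_of_norm_le_const
      (fun s hs => hTn s hs x)).trans_eq (by simp))
  have hR : ∀ x, R x = ∫ s in (0 : ℝ)..1, T s x := fun x => rfl
  have hcomm : ∀ t x, R (S t x) = S t (R x) := fun t x => by
    rw [hR, hR, ← ContinuousLinearMap.intervalIntegral_comp_comm _
      ((hT x).intervalIntegrable _ _)]
    refine intervalIntegral.integral_congr fun s _ => ?_
    simp [T, S.commute]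
  -- the derivative of the rescaled orbit
  have hgen : ∀ x, S.HasGenerator (R x) ((l : ℂ) • R x - (x - T 1 x)) := fun x => by
    have hd : ∀ a : ℝ, Tendsto (fun h : ℝ => (h : ℂ)⁻¹ • ∫ s in a..(a + h), T s x) (𝓝[>] 0)
        (𝓝 (T a x)) := fun a => by
      have h1 := intervalIntegral.integral_hasDerivAt_right
        ((hT x).intervalIntegrable a a)
        ((hT x).stronglyMeasurableAtFilter _ _) (hT x).continuousAt
      have h2 := h1.tendsto_slope_zero_right
      refine h2.congr fun h => ?_
      simp only [intervalIntegral.integral_same, sub_zero]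
      rw [← Complex.ofReal_inv, Complex.coe_smul]
    have hexp : Tendsto (fun h : ℝ => Complex.exp ((l * h : ℝ))) (𝓝[>] 0) (𝓝 1) := by
      have : Continuous fun h : ℝ => Complex.exp ((l * h : ℝ)) := by fun_prop
      have := this.tendsto 0
      simp only [mul_zero, Complex.ofReal_zero, Complex.exp_zero] at this
      exact this.mono_left nhdsWithin_le_nhds
    have hslope : Tendsto (fun h : ℝ => (h : ℂ)⁻¹ * (Complex.exp ((l * h : ℝ)) - 1)) (𝓝[>] 0)
        (𝓝 (l : ℂ)) := by
      have h0 : HasDerivAt (fun h : ℝ => Complex.exp ((l * h : ℝ))) (l : ℂ) 0 := by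
        have h1 : HasDerivAt (fun h : ℝ => ((l * h : ℝ) : ℂ)) ((l * 1 : ℝ) : ℂ) 0 :=
          ((hasDerivAt_id (0 : ℝ)).const_mul l).ofReal_comp
        simpa using h1.cexp
      refine h0.tendsto_slope_zero_right.congr fun h => ?_
      simp only [zero_add, mul_zero, Complex.ofReal_zero, Complex.exp_zero]
      rw [← Complex.ofReal_inv, ← Complex.coe_smul, smul_eq_mul]
    have hlim := (hexp.smul ((hd 1).sub (hd 0))).add (hslope.smul_const (R x))
    have h0 : T 0 x = x := by simp [T, e, S.map_zero']
    rw [h0, one_smul, add_comm] at hlim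
    have e1 : (l : ℂ) • R x - (x - T 1 x) = (l : ℂ) • R x + (T 1 x - x) := by abel
    rw [HasGenerator, e1]
    refine hlim.congr' ?_
    filter_upwards [self_mem_nhdsWithin] with h hh
    have hh : 0 < h := hh
    have hS : S h.toNNReal (R x) = Complex.exp ((l * h : ℝ)) • ∫ s in h..(1 + h), T s x := by
      have e2 : ∫ s in h..(1 + h), T s x = T h (R x) := by
        rw [hR, ← ContinuousLinearMap.intervalIntegral_comp_comm _
          ((hT x).intervalIntegrable _ _)]
        have := intervalIntegral.integral_comp_add_left (fun s => T s x) h (a := 0) (b := 1)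
        rw [add_zero, add_comm h 1] at this
        rw [← this]
        refine intervalIntegral.integral_congr fun s hs => ?_
        rw [Set.uIcc_of_le zero_le_one] at hs
        exact (hadd h s hh.le hs.1 x).symm
      rw [e2]
      simp only [T, e, smul_apply, smul_smul, ← Complex.exp_add]
      simp
    have hI : ∫ s in h..(1 + h), T s x
        = R x + ((∫ s in (1 : ℝ)..(1 + h), T s x) - ∫ s in (0 : ℝ)..(0 + h), T s x) := by
      have i : ∀ a b : ℝ, IntervalIntegrable (fun s => T s x) volume a b := fun a b =>
        (hT x).intervalIntegrable a b
      rw [zero_add, hR, ← intervalIntegral.integral_add_adjacent_intervals (i h 1) (i 1 _),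
        ← intervalIntegral.integral_add_adjacent_intervals (i 0 h) (i h 1)]
      abel
    rw [hS, hI]
    module
  -- `1 - T 1` is invertible
  have hT1 : ‖T 1‖ < 1 := by
    refine (ContinuousLinearMap.opNorm_le_bound _ (by positivity : 0 ≤ Real.exp (-l) * C)
      fun x => ?_).trans_lt ?_
    · simp only [T, smul_apply, norm_smul, hne, mul_one, mul_assoc]
      gcongr
      exact (S _).le_of_opNorm_le (hC _ (by simp)) x
    · rw [Real.exp_neg, inv_mul_lt_iff₀ (Real.exp_pos _), mul_one]
      have := Real.add_one_le_exp l
      simp only [l] at this ⊢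
      linarith
  let V : (X →L[ℂ] X)ˣ := Units.oneSub (T 1) hT1
  have hV1 : ∀ x, (V⁻¹ : (X →L[ℂ] X)ˣ).1 x - T 1 ((V⁻¹ : (X →L[ℂ] X)ˣ).1 x) = x := fun x => by
    have := congrArg (fun L : X →L[ℂ] X => L x) V.mul_inv
    simpa [V] using this
  have hV2 : ∀ x, (V⁻¹ : (X →L[ℂ] X)ˣ).1 (x - T 1 x) = x := fun x => by
    have := congrArg (fun L : X →L[ℂ] X => L x) V.inv_mul
    simpa [V] using this
  have hRV : ∀ x, R ((V⁻¹ : (X →L[ℂ] X)ˣ).1 x) = (V⁻¹ : (X →L[ℂ] X)ˣ).1 (R x) := fun x => by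
    set w := (V⁻¹ : (X →L[ℂ] X)ˣ).1 x with hw
    have : R x = R w - T 1 (R w) := by
      rw [← hV1 x, ← hw, map_sub]
      simp [T, hcomm]
    rw [this, hV2]
  refine ⟨l, R.comp (V⁻¹ : (X →L[ℂ] X)ˣ).1, fun x => ?_, fun x => ?_⟩
  · have h := hgen ((V⁻¹ : (X →L[ℂ] X)ˣ).1 x)
    rw [hV1] at h
    refine ⟨h.mem_domain, ?_⟩
    exact (congrArg _ ((S.hasGenerator_generator ⟨_, h.mem_domain⟩).unique h)).trans
      (sub_sub_cancel _ _)
  · have h := (S.hasGenerator_generator x).map R hcomm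
    have e1 := h.unique (hgen x)
    rw [ContinuousLinearMap.comp_apply, hRV, map_sub, map_smul, e1, sub_sub_cancel, hV2]

/-- The unique bounded extension `S₋₁ t` of `S t` to the extrapolation space. -/
noncomputable def extrapolationMap {X : Type*} [NormedAddCommGroup X] [NormedSpace ℂ X]
    (S : C0Semigroup X) (lam : S.resolventSet) (t : ℝ≥0) :
    Extrapolation S lam →L[ℂ] Extrapolation S lam :=
  ((S.toExtrapolation lam).comp (S t) : X →ₗ[ℂ] Extrapolation S lam).extendOfNorm
    (S.toExtrapolation lam : X →ₗ[ℂ] Extrapolation S lam)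

theorem norm_toExtrapolation_map_le {X : Type*} [NormedAddCommGroup X] [NormedSpace ℂ X]
    (S : C0Semigroup X) (lam : S.resolventSet) (t : ℝ≥0) (x : X) :
    ‖S.toExtrapolation lam (S t x)‖ ≤ ‖S t‖ * ‖S.toExtrapolation lam x‖ := by
  rw [norm_toExtrapolation, norm_toExtrapolation, resolvent_commute]
  exact (S t).le_opNorm _

theorem extrapolationMap_apply {X : Type*} [NormedAddCommGroup X] [NormedSpace ℂ X]
    (S : C0Semigroup X) (lam : S.resolventSet) (t : ℝ≥0) (x : X) :
    S.extrapolationMap lam t (S.toExtrapolation lam x) = S.toExtrapolation lam (S t x) :=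
  LinearMap.extendOfNorm_eq (S.denseRange_toExtrapolation lam)
    ⟨‖S t‖, S.norm_toExtrapolation_map_le lam t⟩ x

theorem norm_extrapolationMap_le {X : Type*} [NormedAddCommGroup X] [NormedSpace ℂ X]
    (S : C0Semigroup X) (lam : S.resolventSet) (t : ℝ≥0) (y : Extrapolation S lam) :
    ‖S.extrapolationMap lam t y‖ ≤ ‖S t‖ * ‖y‖ := by
  refine (S.denseRange_toExtrapolation lam).induction_on y
    (isClosed_le (by fun_prop) (by fun_prop)) fun x => ?_
  rw [extrapolationMap_apply]
  exact S.norm_toExtrapolation_map_le lam t x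

/-- The extrapolated semigroup `S₋₁` on `X₋₁`. -/
noncomputable def extrapolation {X : Type*} [NormedAddCommGroup X] [NormedSpace ℂ X]
    [CompleteSpace X] (S : C0Semigroup X) (lam : S.resolventSet) :
    C0Semigroup (Extrapolation S lam) where
  toFun := S.extrapolationMap lam
  map_zero' := by
    ext y
    refine (S.denseRange_toExtrapolation lam).induction_on y
      (isClosed_eq (by fun_prop) (by fun_prop)) fun x => ?_
    simp [extrapolationMap_apply, S.map_zero']
  map_add' s t := by
    ext y
    refine (S.denseRange_toExtrapolation lam).induction_on y
      (isClosed_eq (by fun_prop) (by fun_prop)) fun x => ?_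
    simp [extrapolationMap_apply, S.map_add']
  strongly_continuous y := by
    refine continuous_of_locally_uniform_approx_of_continuousAt fun t u hu => ?_
    obtain ⟨ε, hε, hu⟩ := Metric.mem_uniformity_dist.1 hu
    obtain ⟨C, hC0, hC⟩ := S.exists_norm_le (t + 1)
    obtain ⟨x, hx⟩ := (S.denseRange_toExtrapolation lam).exists_dist_lt y
      (div_pos hε (by positivity : 0 < C + 1))
    refine ⟨Set.Iio (t + 1), Iio_mem_nhds (lt_add_one t),
      fun s => S.extrapolationMap lam s (S.toExtrapolation lam x), ?_, fun s hs => hu ?_⟩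
    · simp only [extrapolationMap_apply]
      exact ((S.toExtrapolation lam).continuous.comp (S.strongly_continuous x)).continuousAt
    · rw [dist_eq_norm, ← map_sub]
      refine (S.norm_extrapolationMap_le lam s _).trans_lt ?_
      rw [dist_eq_norm, lt_div_iff₀ (by positivity)] at hx
      nlinarith [hC s (le_of_lt hs), norm_nonneg (S s), norm_nonneg (y - S.toExtrapolation lam x)]

theorem exists_hasGenerator_extrapolation {X : Type*} [NormedAddCommGroup X] [NormedSpace ℂ X]
    [CompleteSpace X] (S : C0Semigroup X) (lam : S.resolventSet) (x : X) :
    ∃ y, (S.extrapolation lam).HasGenerator (S.toExtrapolation lam x) y ∧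
      ‖y‖ = ‖(lam : ℂ) • S.resolvent lam x - x‖ := by
  set q : ℝ → X := fun h => (h : ℂ)⁻¹ • (S h.toNNReal x - x)
  have hq : ∀ h : ℝ, (h : ℂ)⁻¹ • ((S.extrapolation lam) h.toNNReal (S.toExtrapolation lam x)
      - S.toExtrapolation lam x) = S.toExtrapolation lam (q h) := fun h => by
    simp [q, extrapolation, extrapolationMap_apply]
  have hR : Tendsto (fun h => S.resolvent lam (q h)) (𝓝[>] 0)
      (𝓝 ((lam : ℂ) • S.resolvent lam x - x)) := by
    refine Tendsto.congr (fun h => ?_) (S.hasGenerator_resolvent lam x)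
    simp [q, resolvent_commute]
  have hcau : Cauchy (map (fun h => S.toExtrapolation lam (q h)) (𝓝[>] (0 : ℝ))) := by
    have h1 := hR.cauchy_map
    rw [Metric.cauchy_iff] at h1 ⊢
    refine ⟨inferInstance, fun ε hε => ?_⟩
    obtain ⟨t, ht, h⟩ := h1.2 ε hε
    refine ⟨(fun h => S.toExtrapolation lam (q h)) '' ((fun h => S.resolvent lam (q h)) ⁻¹' t),
      image_mem_map ht, ?_⟩
    rintro _ ⟨a, ha, rfl⟩ _ ⟨b, hb, rfl⟩
    have := h _ ha _ hb
    rwa [dist_eq_norm, ← map_sub, ← norm_toExtrapolation, map_sub, ← dist_eq_norm] at this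
  obtain ⟨y, hy⟩ := CompleteSpace.complete hcau
  have hy : Tendsto (fun h => S.toExtrapolation lam (q h)) (𝓝[>] (0 : ℝ)) (𝓝 y) := hy
  refine ⟨y, hy.congr fun h => (hq h).symm, ?_⟩
  refine tendsto_nhds_unique hy.norm (hR.norm.congr fun h => ?_)
  rw [norm_toExtrapolation]

/-- The operator `A₋₁ ∈ L(X, X₋₁)`: the generator of `S₋₁`, restricted to `X ⊆ D(A₋₁)`. -/
noncomputable def extrapolatedGenerator {X : Type*} [NormedAddCommGroup X] [NormedSpace ℂ X]
    [CompleteSpace X] (S : C0Semigroup X) (lam : S.resolventSet) :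
    X →L[ℂ] Extrapolation S lam :=
  LinearMap.mkContinuous
    ((S.extrapolation lam).generator.toFun ∘ₗ
      LinearMap.codRestrict (S.extrapolation lam).generator.domain
        (S.toExtrapolation lam : X →ₗ[ℂ] Extrapolation S lam)
        (fun x => (S.exists_hasGenerator_extrapolation lam x).choose_spec.1.mem_domain))
    (‖(lam : ℂ)‖ * ‖S.resolvent lam‖ + 1)
    (fun x => by
      obtain ⟨y, hy, hn⟩ := S.exists_hasGenerator_extrapolation lam x
      have e := ((S.extrapolation lam).hasGenerator_generator ⟨_, hy.mem_domain⟩).unique hy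
      refine (congrArg norm e).trans_le (hn.trans_le ?_)
      refine (norm_sub_le _ _).trans ?_
      rw [norm_smul, add_mul, one_mul, mul_assoc]
      gcongr
      exact (S.resolvent lam).le_opNorm x)

/-- The convolution `(S ∗ f)(t) = ∫₀ᵗ S(t - s) f(s) ds`. -/
noncomputable def convolution {X : Type*} [NormedAddCommGroup X] [NormedSpace ℂ X]
    (S : C0Semigroup X) (f : ℝ → X) (t : ℝ) : X :=
  ∫ s in (0 : ℝ)..t, S (t - s).toNNReal (f s)

/-- Maximal regularity with respect to a function space `F`, where `F τ` is the set of functions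
(considered on `[0, τ]` only) belonging to `F([0, τ], X)`: for some `τ > 0` and all
`f ∈ F([0, τ], X)` it holds that `(S ∗ f)(t) ∈ D(A)` for almost every `t ∈ (0, τ)`, and the almost
everywhere defined function `A (S ∗ f)` belongs to `F([0, τ], X)`. -/
def MaximalRegularity {X : Type*} [NormedAddCommGroup X] [NormedSpace ℂ X]
    (S : C0Semigroup X) (F : ℝ → Set (ℝ → X)) : Prop :=
  ∃ τ : ℝ, 0 < τ ∧ ∀ f ∈ F τ, ∃ g ∈ F τ, ∀ᵐ t ∂volume.restrict (Set.Ioo 0 τ),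
    ∃ h : S.convolution f t ∈ S.generator.domain, S.generator ⟨S.convolution f t, h⟩ = g t

/-- `B ∈ L(U, X₋₁)` is an `F`-admissible control operator: for some `τ > 0` the map
`u ↦ ∫₀^τ S₋₁(τ - t) B u(t) dt` sends `F([0, τ], U)` into `X`. -/
def Admissible {X U : Type*} [NormedAddCommGroup X] [NormedSpace ℂ X] [CompleteSpace X]
    [NormedAddCommGroup U] [NormedSpace ℂ U]
    (S : C0Semigroup X) (lam : S.resolventSet) (F : ℝ → Set (ℝ → U))
    (B : U →L[ℂ] Extrapolation S lam) : Prop :=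
  ∃ τ : ℝ, 0 < τ ∧ ∀ u ∈ F τ, ∃ x : X,
    ∫ t in (0 : ℝ)..τ, S.extrapolation lam (τ - t).toNNReal (B (u t)) = S.toExtrapolation lam x

/-- The semivariation of the semigroup on `[0, τ]`: the supremum of
`‖∑ᵢ (S(tᵢ) - S(tᵢ₊₁)) xᵢ‖` over all partitions `0 = t₀ < ⋯ < tₙ = τ` and all `‖xᵢ‖ ≤ 1`. -/
noncomputable def semivariation {X : Type*} [NormedAddCommGroup X] [NormedSpace ℂ X]
    (S : C0Semigroup X) (τ : ℝ≥0) : ℝ≥0∞ :=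
  ⨆ (n : ℕ) (t : Fin (n + 1) → ℝ≥0) (x : Fin n → X)
    (_ : StrictMono t ∧ t 0 = 0 ∧ t (Fin.last n) = τ ∧ ∀ i, ‖x i‖ ≤ 1),
    ‖∑ i : Fin n, (S (t i.castSucc) - S (t i.succ)) (x i)‖ₑ

/-- The semigroup is of bounded semivariation: its semivariation on `[0, τ]` is finite for all
`τ > 0`. -/
def BoundedSemivariation {X : Type*} [NormedAddCommGroup X] [NormedSpace ℂ X]
    (S : C0Semigroup X) : Prop :=
  ∀ τ : ℝ≥0, 0 < τ → S.semivariation τ < ∞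

end C0Semigroup

/-- `C([0, τ], E)`. -/
def continuousFunctions (E : Type*) [NormedAddCommGroup E] (τ : ℝ) : Set (ℝ → E) :=
  {f | ContinuousOn f (Set.Icc 0 τ)}

/-- `Reg([0, τ], E)`: the regulated functions, having a right limit at every point of `[0, τ)` and
a left limit at every point of `(0, τ]`. -/
def regulatedFunctions (E : Type*) [NormedAddCommGroup E] (τ : ℝ) : Set (ℝ → E) :=
  {f | (∀ t ∈ Set.Ico 0 τ, ∃ y, Tendsto f (𝓝[>] t) (𝓝 y)) ∧
    ∀ t ∈ Set.Ioc 0 τ, ∃ y, Tendsto f (𝓝[<] t) (𝓝 y)}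

/-! Everything reduces to the question whether the convolution `(S ∗ u)(τ)` lies in `D(A)`. Since
`A₋₁` is bounded and commutes with the semigroups, the integral in the definition of admissibility
is `A₋₁ (S ∗ u)(τ)`, and `A₋₁ x` belongs to `X` exactly when `x ∈ D(A)`
(`admissible_extrapolatedGenerator_iff`).

Semivariation enters through `A ∫ₐᵇ S(t - s) c ds = S(t - a) c - S(t - b) c`: for a step function
`g`, the vector `A (S ∗ g)(t)` is one of the sums defining the semivariation. If the semivariation
is finite, it bounds `g ↦ A (S ∗ g)(t)` in the sup norm, uniformly in `t`. Regulated functions are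
uniform limits of step functions and `A` is closed, so `A (S ∗ f)` is a uniform limit of continuous
functions (`exists_continuousOn_hasGenerator_convolution`). This gives both kinds of maximal
regularity at once.

Conversely, maximal regularity gives `(S ∗ u)(t) ∈ D(A)` for almost every `t`, and closedness
carries this to the endpoint `τ`. If `(S ∗ u)(τ) ∈ D(A)` for all continuous `u`, the same holds on
every interval, and the closed graph theorem bounds `u ↦ A (S ∗ u)(t)`. Approximating step functions
pointwise by continuous functions of norm at most one then bounds the semivariation sums; the images
under `A` need not converge, but lower semicontinuity of the graph norm suffices
(`HasGenerator.norm_le_of_tendsto`). -/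

namespace C0Semigroup

/-! ### The generator: closedness, orbits and integrals -/

section generator

variable {X : Type*} [NormedAddCommGroup X] [NormedSpace ℂ X] (S : C0Semigroup X)

theorem apply_apply (s t : ℝ≥0) (x : X) : S s (S t x) = S (s + t) x := by
  rw [S.map_add', ContinuousLinearMap.comp_apply]

theorem apply_zero (x : X) : S 0 x = x := by
  rw [S.map_zero', ContinuousLinearMap.id_apply]

theorem continuous_orbit (x : X) : Continuous fun t : ℝ => S t.toNNReal x :=
  (S.strongly_continuous x).comp continuous_real_toNNReal

theorem hasGenerator_zero : S.HasGenerator 0 0 := by simp [HasGenerator]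

variable {S}

theorem HasGenerator.sub {x y x' y' : X} (h : S.HasGenerator x y) (h' : S.HasGenerator x' y') :
    S.HasGenerator (x - x') (y - y') := by
  have := h.add (h'.smul (-1))
  simpa [sub_eq_add_neg] using this

theorem HasGenerator.map_semigroup {x y : X} (h : S.HasGenerator x y) (t : ℝ≥0) :
    S.HasGenerator (S t x) (S t y) :=
  h.map (S t) fun s x => S.commute t s x

theorem HasGenerator.generator_eq {x y : X} (h : S.HasGenerator x y) :
    S.generator ⟨x, h.mem_domain⟩ = y :=
  (S.hasGenerator_generator ⟨x, h.mem_domain⟩).unique h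

theorem mem_domain_iff {x : X} : x ∈ S.generator.domain ↔ ∃ y, S.HasGenerator x y := Iff.rfl

/-- Replaces the unbounded operator by an equation for the bounded resolvent, which passes to limits
and through integrals. -/
theorem hasGenerator_iff (lam : S.resolventSet) {x y : X} :
    S.HasGenerator x y ↔ S.resolvent lam ((lam : ℂ) • x - y) = x := by
  constructor
  · intro h
    have := (S.resolvent_spec lam).2 ⟨x, h.mem_domain⟩
    rwa [h.generator_eq] at this
  · intro h
    have := S.hasGenerator_resolvent lam ((lam : ℂ) • x - y)
    rwa [h, sub_sub_cancel] at this

variable [CompleteSpace X]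

/-- The generator is closed. -/
theorem hasGenerator_of_tendsto {ι : Type*} {l : Filter ι} [l.NeBot] {u v : ι → X} {x y : X}
    (hu : Tendsto u l (𝓝 x)) (hv : Tendsto v l (𝓝 y))
    (h : ∀ᶠ i in l, S.HasGenerator (u i) (v i)) : S.HasGenerator x y := by
  obtain ⟨lam, hlam⟩ := S.resolventSet_nonempty
  rw [hasGenerator_iff ⟨lam, hlam⟩]
  refine tendsto_nhds_unique_of_eventuallyEq
    (((S.resolvent ⟨lam, hlam⟩).continuous.tendsto _).comp ((hu.const_smul lam).sub hv)) hu ?_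
  filter_upwards [h] with i hi
  exact (hasGenerator_iff ⟨lam, hlam⟩).1 hi

variable (S)

/-- Strong continuity together with the local uniform bound on `‖S t‖`. It yields measurability of
`s ↦ S(d - s) f(s)` and limits in which time and vector move together. -/
theorem continuous_uncurry : Continuous fun p : ℝ≥0 × X => S p.1 p.2 := by
  refine continuous_iff_continuousAt.2 fun ⟨t, x⟩ => ?_
  obtain ⟨C, hC0, hC⟩ := S.exists_norm_le (t + 1)
  have h1 : Tendsto (fun p : ℝ≥0 × X => S p.1 x) (𝓝 (t, x)) (𝓝 (S t x)) :=
    ((S.strongly_continuous x).comp continuous_fst).tendsto (t, x)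
  have h2 : Tendsto (fun p : ℝ≥0 × X => S p.1 (p.2 - x)) (𝓝 (t, x)) (𝓝 0) := by
    have h3 : Tendsto (fun p : ℝ≥0 × X => C * ‖p.2 - x‖) (𝓝 (t, x)) (𝓝 0) := by
      have : Continuous fun p : ℝ≥0 × X => C * ‖p.2 - x‖ := by fun_prop
      simpa using this.tendsto (t, x)
    refine squeeze_zero_norm' ?_ h3
    have h4 : ∀ᶠ p : ℝ≥0 × X in 𝓝 (t, x), p.1 < t + 1 :=
      continuous_fst.continuousAt.eventually (Iio_mem_nhds (lt_add_one t))
    filter_upwards [h4] with p hp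
    exact (S p.1).le_of_opNorm_le (hC _ hp.le) _
  have := h1.add h2
  simp only [map_sub, add_sub_cancel, add_zero] at this
  exact this

/-- Applying `S h` shifts the window of integration by `h`, so the difference leaves only the two
end pieces over `[b, b + h]` and `[a, a + h]`; divided by `h` they tend to the integrand at `b` and
`a`. -/
theorem hasGenerator_integral {a b : ℝ} (ha : 0 ≤ a) (hab : a ≤ b) (x : X) :
    S.HasGenerator (∫ s in a..b, S s.toNNReal x) (S b.toNNReal x - S a.toNNReal x) := by
  have hc := S.continuous_orbit x
  have hi : ∀ c d : ℝ, IntervalIntegrable (fun s : ℝ => S s.toNNReal x) volume c d :=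
    fun c d => hc.intervalIntegrable c d
  have hd : ∀ c : ℝ, Tendsto (fun h : ℝ => (h : ℂ)⁻¹ • ∫ s in c..(c + h), S s.toNNReal x)
      (𝓝[>] 0) (𝓝 (S c.toNNReal x)) := fun c => by
    have h2 := (intervalIntegral.integral_hasDerivAt_right (hi c c)
      (hc.stronglyMeasurableAtFilter _ _) hc.continuousAt).tendsto_slope_zero_right
    refine h2.congr fun h => ?_
    simp only [intervalIntegral.integral_same, sub_zero]
    rw [← Complex.ofReal_inv, Complex.coe_smul]
  refine ((hd b).sub (hd a)).congr' ?_
  filter_upwards [self_mem_nhdsWithin] with h hh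
  have hh : 0 < h := hh
  rw [← smul_sub]
  congr 1
  have e : S h.toNNReal (∫ s in a..b, S s.toNNReal x) = ∫ s in (a + h)..(b + h), S s.toNNReal x := by
    rw [← ContinuousLinearMap.intervalIntegral_comp_comm _ (hi a b),
      ← intervalIntegral.integral_comp_add_right (fun s : ℝ => S s.toNNReal x) h]
    refine intervalIntegral.integral_congr fun s hs => ?_
    rw [uIcc_of_le hab] at hs
    simp only [apply_apply]
    rw [add_comm, Real.toNNReal_add (ha.trans hs.1) hh.le]
  rw [e, ← intervalIntegral.integral_add_adjacent_intervals (hi (a + h) b) (hi b (b + h)),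
    ← intervalIntegral.integral_add_adjacent_intervals (hi a (a + h)) (hi (a + h) b)]
  abel

variable {S}

/-- Both sides are the value of `A` at `∫₀ᵗ S(s) x ds`: the left one by `hasGenerator_integral`, the
right one by integrating the resolvent equation along the orbit. -/
theorem HasGenerator.orbit_sub_eq_integral {x y : X} (h : S.HasGenerator x y) {t : ℝ}
    (ht : 0 ≤ t) : S t.toNNReal x - x = ∫ s in (0 : ℝ)..t, S s.toNNReal y := by
  obtain ⟨lam, hlam⟩ := S.resolventSet_nonempty
  have h1 := S.hasGenerator_integral le_rfl ht x
  rw [Real.toNNReal_zero, apply_zero] at h1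
  refine h1.unique ((hasGenerator_iff ⟨lam, hlam⟩).2 ?_)
  have hi : ∀ z : X, IntervalIntegrable (fun s : ℝ => S s.toNNReal z) volume 0 t :=
    fun z => (S.continuous_orbit z).intervalIntegrable 0 t
  have hi' : IntervalIntegrable (fun s : ℝ => lam • S s.toNNReal x) volume 0 t :=
    ((S.continuous_orbit x).const_smul lam).intervalIntegrable 0 t
  rw [← intervalIntegral.integral_smul, ← intervalIntegral.integral_sub hi' (hi y),
    ← ContinuousLinearMap.intervalIntegral_comp_comm _ (hi'.sub (hi y))]
  refine intervalIntegral.integral_congr fun s _ => ?_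
  exact (hasGenerator_iff ⟨lam, hlam⟩).1 (h.map_semigroup s.toNNReal)

/-- Lower semicontinuity of the graph norm, up to a constant. -/
theorem HasGenerator.norm_le_of_tendsto {C K : ℝ} (hC : ∀ t ≤ 1, ‖S t‖ ≤ C) {u v : ℕ → X}
    {x y : X} (h : S.HasGenerator x y) (hu : Tendsto u atTop (𝓝 x))
    (huv : ∀ n, S.HasGenerator (u n) (v n)) (hv : ∀ n, ‖v n‖ ≤ K) : ‖y‖ ≤ C * K := by
  have hC0 : 0 ≤ C := (norm_nonneg _).trans (hC 0 zero_le_one)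
  refine le_of_tendsto h.norm ?_
  -- For fixed `r < 1` the difference quotient of `u n` is the mean of `S(s) (v n)` over `[0, r]`,
  -- hence at most `C * K` uniformly in `n`. The limit in `n` is taken first, then `r → 0+`.
  filter_upwards [Ioo_mem_nhdsGT (zero_lt_one (α := ℝ))] with r hr
  have h1 : Tendsto (fun n => (r : ℂ)⁻¹ • (S r.toNNReal (u n) - u n)) atTop
      (𝓝 ((r : ℂ)⁻¹ • (S r.toNNReal x - x))) :=
    ((((S r.toNNReal).continuous.tendsto x).comp hu).sub hu).const_smul _
  refine le_of_tendsto' h1.norm fun n => ?_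
  rw [(huv n).orbit_sub_eq_integral hr.1.le, norm_smul, norm_inv, Complex.norm_real,
    Real.norm_of_nonneg hr.1.le, inv_mul_le_iff₀ hr.1, mul_comm]
  refine (intervalIntegral.norm_integral_le_of_norm_le_const (C := C * K) fun s hs => ?_).trans_eq
    (by rw [sub_zero, abs_of_pos hr.1])
  rw [uIoc_of_le hr.1.le] at hs
  refine ((S _).le_opNorm _).trans (mul_le_mul (hC _ ?_) (hv n) (norm_nonneg _) hC0)
  exact Real.toNNReal_le_one.2 (hs.2.trans hr.2.le)

/-! ### The extrapolated generator in terms of the generator -/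

variable (S)

theorem hasGenerator_extrapolatedGenerator (lam : S.resolventSet) (x : X) :
    (S.extrapolation lam).HasGenerator (S.toExtrapolation lam x)
      (S.extrapolatedGenerator lam x) :=
  (S.extrapolation lam).hasGenerator_generator ⟨_, _⟩

theorem extrapolation_apply (lam : S.resolventSet) (t : ℝ≥0) (x : X) :
    S.extrapolation lam t (S.toExtrapolation lam x) = S.toExtrapolation lam (S t x) :=
  S.extrapolationMap_apply lam t x

theorem extrapolation_extrapolatedGenerator (lam : S.resolventSet) (t : ℝ≥0) (x : X) :
    S.extrapolation lam t (S.extrapolatedGenerator lam x) =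
      S.extrapolatedGenerator lam (S t x) := by
  have h := (S.hasGenerator_extrapolatedGenerator lam x).map_semigroup t
  rw [extrapolation_apply] at h
  exact h.unique (S.hasGenerator_extrapolatedGenerator lam _)

/-- `A₋₁ x` lies in `X` exactly if `x ∈ D(A)`, and then it is `A x`. -/
theorem extrapolatedGenerator_eq_iff (lam : S.resolventSet) {x y : X} :
    S.extrapolatedGenerator lam x = S.toExtrapolation lam y ↔ S.HasGenerator x y := by
  constructor
  · intro e
    have h := S.hasGenerator_extrapolatedGenerator lam x
    rw [e] at h
    -- The norm of `X₋₁` on `X` is the norm of `X` after the resolvent, so convergence of difference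
    -- quotients in `X₋₁` is convergence in `X` of their resolvent images.
    have h1 : S.HasGenerator (S.resolvent lam x) (S.resolvent lam y) := by
      refine tendsto_iff_norm_sub_tendsto_zero.2
        ((tendsto_iff_norm_sub_tendsto_zero.1 h).congr fun r => ?_)
      rw [extrapolation_apply, ← map_sub, ← map_smul, ← map_sub, norm_toExtrapolation, map_sub,
        map_smul, map_sub, resolvent_commute]
    have h2 := h1.unique (S.hasGenerator_resolvent lam x)
    rw [hasGenerator_iff lam, map_sub, map_smul, h2, sub_sub_cancel]
  · intro h
    refine (S.hasGenerator_extrapolatedGenerator lam x).unique ?_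
    refine (((S.toExtrapolation lam).continuous.tendsto y).comp h).congr fun r => ?_
    simp [extrapolation_apply]

end generator

end C0Semigroup

/-! ### Finite partitions, step functions and regulated functions -/

/-- If a hereditary property of sets holds on one-sided neighbourhoods of all points of `[0, τ]`,
then `[0, τ]` has a finite partition into intervals satisfying it. -/
theorem reflTransGen_of_forall_exists_Ioo {τ : ℝ} (hτ : 0 ≤ τ) {G : Set ℝ → Prop}
    (hG : ∀ ⦃s t : Set ℝ⦄, s ⊆ t → G t → G s) (hr : ∀ p ∈ Ico 0 τ, ∃ b > p, G (Ioo p b))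
    (hl : ∀ p ∈ Ioc 0 τ, ∃ a < p, G (Ioo a p)) :
    Relation.ReflTransGen (fun a b => a < b ∧ G (Ioo a b)) 0 τ := by
  set R : ℝ → ℝ → Prop := fun a b => a < b ∧ G (Ioo a b)
  -- The supremum of the reachable points is itself reachable, by its left neighbourhood; if it were
  -- below `τ`, its right neighbourhood would produce a larger reachable point.
  let s : Set ℝ := {b | b ∈ Icc 0 τ ∧ Relation.ReflTransGen R 0 b}
  have h0 : (0 : ℝ) ∈ s := ⟨⟨le_rfl, hτ⟩, .refl⟩
  have hb : BddAbove s := ⟨τ, fun b hb => hb.1.2⟩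
  have hc0 : 0 ≤ sSup s := le_csSup hb h0
  have hcτ : sSup s ≤ τ := csSup_le ⟨0, h0⟩ fun b hb => hb.1.2
  have hc : Relation.ReflTransGen R 0 (sSup s) := by
    rcases hc0.eq_or_lt with h | h
    · rw [← h]
    · obtain ⟨a, ha, hGa⟩ := hl _ ⟨h, hcτ⟩
      obtain ⟨b, hbs, hab⟩ := exists_lt_of_lt_csSup ⟨0, h0⟩ ha
      rcases (le_csSup hb hbs).eq_or_lt with h' | h'
      · rw [← h']; exact hbs.2
      · exact hbs.2.tail ⟨h', hG (Ioo_subset_Ioo_left hab.le) hGa⟩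
  rcases hcτ.eq_or_lt with h | h
  · rwa [h] at hc
  · obtain ⟨b, hb', hGb⟩ := hr _ ⟨hc0, h⟩
    have hlt : sSup s < min b τ := lt_min hb' h
    exact absurd (le_csSup hb (show min b τ ∈ s from ⟨⟨hc0.trans hlt.le, min_le_right _ _⟩,
      hc.tail ⟨hlt, hG (Ioo_subset_Ioo_right (min_le_left _ _)) hGb⟩⟩)) hlt.not_ge

section step

variable {E : Type*} [NormedAddCommGroup E]

/-- Bounded strongly measurable functions that are constant on one-sided neighbourhoods. -/
structure IsStepFunction (g : ℝ → E) : Prop where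
  stronglyMeasurable : StronglyMeasurable g
  bounded : ∃ C, ∀ s, ‖g s‖ ≤ C
  right : ∀ p, ∃ c, ∀ᶠ s in 𝓝[>] p, g s = c
  left : ∀ p, ∃ c, ∀ᶠ s in 𝓝[<] p, g s = c

namespace IsStepFunction

theorem const (c : E) : IsStepFunction fun _ : ℝ => c :=
  ⟨stronglyMeasurable_const, ⟨‖c‖, fun _ => le_rfl⟩, fun _ => ⟨c, by simp⟩, fun _ => ⟨c, by simp⟩⟩

theorem sub {f g : ℝ → E} (hf : IsStepFunction f) (hg : IsStepFunction g) :
    IsStepFunction fun s => f s - g s := by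
  refine ⟨hf.1.sub hg.1, ?_, fun p => ?_, fun p => ?_⟩
  · obtain ⟨C, hC⟩ := hf.2
    obtain ⟨D, hD⟩ := hg.2
    exact ⟨C + D, fun s => (norm_sub_le _ _).trans (add_le_add (hC s) (hD s))⟩
  · obtain ⟨c, hc⟩ := hf.3 p
    obtain ⟨d, hd⟩ := hg.3 p
    exact ⟨c - d, by filter_upwards [hc, hd] with s h1 h2; rw [h1, h2]⟩
  · obtain ⟨c, hc⟩ := hf.4 p
    obtain ⟨d, hd⟩ := hg.4 p
    exact ⟨c - d, by filter_upwards [hc, hd] with s h1 h2; rw [h1, h2]⟩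

open scoped Classical in
theorem piecewise {f g : ℝ → E} (hf : IsStepFunction f) (hg : IsStepFunction g) {A : Set ℝ}
    (hA : MeasurableSet A) (hr : ∀ p, (∀ᶠ s in 𝓝[>] p, s ∈ A) ∨ ∀ᶠ s in 𝓝[>] p, s ∉ A)
    (hl : ∀ p, (∀ᶠ s in 𝓝[<] p, s ∈ A) ∨ ∀ᶠ s in 𝓝[<] p, s ∉ A) :
    IsStepFunction (A.piecewise f g) := by
  have key : ∀ l : Filter ℝ, ((∀ᶠ s in l, s ∈ A) ∨ ∀ᶠ s in l, s ∉ A) →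
      (∃ c, ∀ᶠ s in l, f s = c) → (∃ c, ∀ᶠ s in l, g s = c) →
      ∃ c, ∀ᶠ s in l, A.piecewise f g s = c := by
    rintro l (h | h) ⟨c, hc⟩ ⟨d, hd⟩
    · exact ⟨c, by filter_upwards [h, hc] with s h1 h2; rw [piecewise_eq_of_mem _ _ _ h1, h2]⟩
    · exact ⟨d, by filter_upwards [h, hd] with s h1 h2; rw [piecewise_eq_of_notMem _ _ _ h1, h2]⟩
  refine ⟨hf.1.piecewise hA hg.1, ?_, fun p => key _ (hr p) (hf.3 p) (hg.3 p),
    fun p => key _ (hl p) (hf.4 p) (hg.4 p)⟩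
  obtain ⟨C, hC⟩ := hf.2
  obtain ⟨D, hD⟩ := hg.2
  refine ⟨max C D, fun s => ?_⟩
  by_cases h : s ∈ A
  · rw [piecewise_eq_of_mem _ _ _ h]; exact (hC s).trans (le_max_left _ _)
  · rw [piecewise_eq_of_notMem _ _ _ h]; exact (hD s).trans (le_max_right _ _)

open scoped Classical in
theorem piecewise_Iic {f g : ℝ → E} (hf : IsStepFunction f) (hg : IsStepFunction g) (a : ℝ) :
    IsStepFunction ((Iic a).piecewise f g) := by
  refine hf.piecewise hg measurableSet_Iic (fun p => ?_) fun p => ?_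
  · rcases lt_or_ge p a with h | h
    · left; filter_upwards [Ioo_mem_nhdsGT h] with s hs using hs.2.le
    · right; filter_upwards [self_mem_nhdsWithin] with s hs using not_le.2 (h.trans_lt hs)
  · rcases le_or_gt p a with h | h
    · left; filter_upwards [self_mem_nhdsWithin] with s hs using (le_of_lt hs).trans h
    · right; filter_upwards [Ioo_mem_nhdsLT h] with s hs using not_le.2 hs.1

open scoped Classical in
theorem piecewise_Iio {f g : ℝ → E} (hf : IsStepFunction f) (hg : IsStepFunction g) (a : ℝ) :
    IsStepFunction ((Iio a).piecewise f g) := by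
  refine hf.piecewise hg measurableSet_Iio (fun p => ?_) fun p => ?_
  · rcases lt_or_ge p a with h | h
    · left; filter_upwards [Ioo_mem_nhdsGT h] with s hs using hs.2
    · right; filter_upwards [self_mem_nhdsWithin] with s hs using not_lt.2 (h.trans (le_of_lt hs))
  · rcases le_or_gt p a with h | h
    · left; filter_upwards [self_mem_nhdsWithin] with s hs using lt_of_lt_of_le hs h
    · right; filter_upwards [Ioo_mem_nhdsLT h] with s hs using not_lt.2 hs.1.le

/-- A step function takes constant values on the intervals of a finite partition. -/
theorem reflTransGen {g : ℝ → E} (hg : IsStepFunction g) {τ ε : ℝ} (hτ : 0 ≤ τ)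
    (hε : ∀ s ∈ Icc 0 τ, ‖g s‖ ≤ ε) :
    Relation.ReflTransGen
      (fun a b => a < b ∧ ∃ c, ‖c‖ ≤ ε ∧ ∀ s ∈ Ioo a b, g s = c) 0 τ := by
  refine reflTransGen_of_forall_exists_Ioo (G := fun I => ∃ c, ‖c‖ ≤ ε ∧ ∀ s ∈ I, g s = c) hτ
    (fun s t hst ⟨c, hc, h⟩ => ⟨c, hc, fun r hr => h r (hst hr)⟩) (fun p hp => ?_) fun p hp => ?_
  · obtain ⟨c, hc⟩ := hg.right p
    obtain ⟨b, hb, h⟩ := (mem_nhdsGT_iff_exists_Ioo_subset).1 hc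
    -- The constant is an actual value of `g` at a point of `[0, τ]`, so it inherits the bound `ε`.
    obtain ⟨s, hs, hs'⟩ := (hc.and (Ioo_mem_nhdsGT hp.2)).exists
    exact ⟨b, hb, c, hs ▸ hε s ⟨hp.1.trans hs'.1.le, hs'.2.le⟩, fun r hr => h hr⟩
  · obtain ⟨c, hc⟩ := hg.left p
    obtain ⟨b, hb, h⟩ := (mem_nhdsLT_iff_exists_Ioo_subset).1 hc
    obtain ⟨s, hs, hs'⟩ := (hc.and (Ioo_mem_nhdsLT hp.1)).exists
    exact ⟨b, hb, c, hs ▸ hε s ⟨hs'.1.le, hs'.2.le.trans hp.2⟩, fun r hr => h hr⟩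

end IsStepFunction

/-- Regulated functions are uniform limits of step functions. -/
theorem exists_isStepFunction_norm_sub_le {f : ℝ → E} {τ : ℝ} (hτ : 0 ≤ τ)
    (hf : f ∈ regulatedFunctions E τ) {ε : ℝ} (hε : 0 < ε) :
    ∃ g, IsStepFunction g ∧ ∀ s ∈ Icc 0 τ, ‖f s - g s‖ ≤ ε := by
  classical
  have h : Relation.ReflTransGen
      (fun a b => a < b ∧ ∃ c, ∀ s ∈ Ioo a b, ‖f s - c‖ ≤ ε) 0 τ := by
    refine reflTransGen_of_forall_exists_Ioo (G := fun I => ∃ c, ∀ s ∈ I, ‖f s - c‖ ≤ ε) hτ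
      (fun s t hst ⟨c, h⟩ => ⟨c, fun r hr => h r (hst hr)⟩) (fun p hp => ?_) fun p hp => ?_
    · obtain ⟨c, hc⟩ := hf.1 p hp
      obtain ⟨b, hb, h⟩ := (mem_nhdsGT_iff_exists_Ioo_subset).1
        (hc.eventually (Metric.closedBall_mem_nhds c hε))
      exact ⟨b, hb, c, fun r hr => by simpa [dist_eq_norm] using h hr⟩
    · obtain ⟨c, hc⟩ := hf.2 p hp
      obtain ⟨b, hb, h⟩ := (mem_nhdsLT_iff_exists_Ioo_subset).1
        (hc.eventually (Metric.closedBall_mem_nhds c hε))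
      exact ⟨b, hb, c, fun r hr => by simpa [dist_eq_norm] using h hr⟩
  clear hf hτ
  induction h with
  | refl =>
    refine ⟨fun _ => f 0, .const _, fun s hs => ?_⟩
    rw [le_antisymm hs.2 hs.1, sub_self, norm_zero]
    exact hε.le
  | tail _ hab ih =>
    rename_i a b _
    obtain ⟨hab, c, hc⟩ := hab
    obtain ⟨g, hg, hfg⟩ := ih
    -- The value at `b` is prescribed separately, because `f b` may differ from the one-sided limits
    -- of `f` there.
    refine ⟨(Iic a).piecewise g ((Iio b).piecewise (fun _ => c) fun _ => f b),
      hg.piecewise_Iic ((IsStepFunction.const _).piecewise_Iio (.const _) b) a, fun s hs => ?_⟩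
    by_cases h1 : s ∈ Iic a
    · rw [piecewise_eq_of_mem _ _ _ h1]
      exact hfg s ⟨hs.1, h1⟩
    · rw [piecewise_eq_of_notMem _ _ _ h1]
      by_cases h2 : s ∈ Iio b
      · rw [piecewise_eq_of_mem _ _ _ h2]
        exact hc s ⟨not_le.1 h1, h2⟩
      · rw [piecewise_eq_of_notMem _ _ _ h2, le_antisymm hs.2 (not_lt.1 h2), sub_self, norm_zero]
        exact hε.le

theorem continuousFunctions_subset_regulatedFunctions (τ : ℝ) :
    continuousFunctions E τ ⊆ regulatedFunctions E τ := by
  refine fun f hf => ⟨fun t ht => ⟨f t, ?_⟩, fun t ht => ⟨f t, ?_⟩⟩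
  · exact (hf t ⟨ht.1, ht.2.le⟩).mono_left
      (nhdsWithin_le_of_mem (mem_of_superset (Ioo_mem_nhdsGT ht.2)
        fun s hs => ⟨ht.1.trans hs.1.le, hs.2.le⟩))
  · exact (hf t ⟨ht.1.le, ht.2⟩).mono_left
      (nhdsWithin_le_of_mem (mem_of_superset (Ioo_mem_nhdsLT ht.1)
        fun s hs => ⟨hs.1.le, hs.2.le.trans ht.2⟩))

/-- Measurability and boundedness on `[0, τ]`, which is what the convolution needs. -/
structure IsBoundedMeasurable (f : ℝ → E) (τ : ℝ) : Prop where
  aestronglyMeasurable : AEStronglyMeasurable f (volume.restrict (Icc 0 τ))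
  bounded : ∃ C, ∀ s ∈ Icc 0 τ, ‖f s‖ ≤ C

theorem IsStepFunction.isBoundedMeasurable {g : ℝ → E} (hg : IsStepFunction g) (τ : ℝ) :
    IsBoundedMeasurable g τ :=
  ⟨hg.1.aestronglyMeasurable, hg.2.imp fun _ h s _ => h s⟩

theorem IsBoundedMeasurable.mono {f : ℝ → E} {τ t : ℝ} (hf : IsBoundedMeasurable f τ)
    (h : t ≤ τ) : IsBoundedMeasurable f t :=
  ⟨hf.1.mono_set (Icc_subset_Icc_right h), hf.2.imp fun _ hC s hs => hC s ⟨hs.1, hs.2.trans h⟩⟩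

/-- Both properties are inherited from step functions under uniform approximation. -/
theorem isBoundedMeasurable_of_regulated {f : ℝ → E} {τ : ℝ} (hτ : 0 ≤ τ)
    (hf : f ∈ regulatedFunctions E τ) : IsBoundedMeasurable f τ := by
  have h : ∀ n : ℕ, ∃ g, IsStepFunction g ∧ ∀ s ∈ Icc 0 τ, ‖f s - g s‖ ≤ 1 / ((n : ℝ) + 1) :=
    fun n => exists_isStepFunction_norm_sub_le hτ hf (by positivity)
  choose g hg hfg using h
  constructor
  · refine aestronglyMeasurable_of_tendsto_ae atTop
      (fun n => (hg n).stronglyMeasurable.aestronglyMeasurable) ?_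
    filter_upwards [ae_restrict_mem measurableSet_Icc] with s hs
    rw [tendsto_iff_norm_sub_tendsto_zero]
    refine squeeze_zero (fun _ => norm_nonneg _) (fun n => ?_)
      (tendsto_one_div_add_atTop_nhds_zero_nat (𝕜 := ℝ))
    rw [norm_sub_rev]
    exact hfg n s hs
  · obtain ⟨C, hC⟩ := (hg 0).bounded
    refine ⟨C + 1, fun s hs => ?_⟩
    have := hfg 0 s hs
    simp only [Nat.cast_zero, zero_add, div_one] at this
    have h2 := norm_add_le (g 0 s) (f s - g 0 s)
    rw [add_sub_cancel] at h2
    linarith [hC s]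

theorem isBoundedMeasurable_of_continuousOn {f : ℝ → E} {τ : ℝ} (hτ : 0 ≤ τ)
    (hf : ContinuousOn f (Icc 0 τ)) : IsBoundedMeasurable f τ :=
  isBoundedMeasurable_of_regulated hτ (continuousFunctions_subset_regulatedFunctions τ hf)

end step

namespace C0Semigroup

/-! ### The convolution, and its regularity under bounded semivariation -/

section convolution

variable {X : Type*} [NormedAddCommGroup X] [NormedSpace ℂ X] (S : C0Semigroup X)

theorem integral_apply_sub_congr {g : ℝ → X} {a b d : ℝ} {c : X} (hab : a ≤ b)
    (h : ∀ s ∈ Ioo a b, g s = c) :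
    ∫ s in a..b, S (d - s).toNNReal (g s) = ∫ s in a..b, S (d - s).toNNReal c := by
  rw [intervalIntegral.integral_of_le hab, intervalIntegral.integral_of_le hab,
    integral_Ioc_eq_integral_Ioo, integral_Ioc_eq_integral_Ioo]
  exact setIntegral_congr_fun measurableSet_Ioo fun s hs => by simp only [h s hs]

theorem norm_sum_le_semivariation {τ : ℝ≥0} (hS : S.semivariation τ < ∞) {n : ℕ}
    {p : Fin (n + 1) → ℝ≥0} (hp : StrictMono p) (h0 : p 0 = 0) (hl : p (Fin.last n) = τ)
    {x : Fin n → X} {ε : ℝ} (hε : 0 < ε) (hx : ∀ i, ‖x i‖ ≤ ε) :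
    ‖∑ i : Fin n, (S (p i.castSucc) - S (p i.succ)) (x i)‖ ≤ (S.semivariation τ).toReal * ε := by
  have h1 : ∀ i, ‖((ε : ℂ)⁻¹ • x i)‖ ≤ 1 := fun i => by
    rw [norm_smul, norm_inv, Complex.norm_real, Real.norm_of_nonneg hε.le, inv_mul_le_iff₀ hε,
      mul_one]
    exact hx i
  have h2 : ‖∑ i : Fin n, (S (p i.castSucc) - S (p i.succ)) ((ε : ℂ)⁻¹ • x i)‖ₑ ≤
      S.semivariation τ :=
    le_iSup_of_le n (le_iSup_of_le p (le_iSup_of_le _ (le_iSup_of_le ⟨hp, h0, hl, h1⟩ le_rfl)))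
  simp only [map_smul, ← Finset.smul_sum] at h2
  rw [← ofReal_norm, ENNReal.ofReal_le_iff_le_toReal hS.ne, norm_smul, norm_inv,
    Complex.norm_real, Real.norm_of_nonneg hε.le, inv_mul_le_iff₀ hε, mul_comm] at h2
  exact h2

theorem norm_convolution_le {M : ℝ} {t : ℝ} (ht : 0 ≤ t) (hM : ∀ s ≤ t.toNNReal, ‖S s‖ ≤ M)
    {f : ℝ → X} {C : ℝ} (hf : ∀ s ∈ Icc 0 t, ‖f s‖ ≤ C) :
    ‖S.convolution f t‖ ≤ M * C * t := by
  have hM0 : 0 ≤ M := (norm_nonneg _).trans (hM 0 zero_le)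
  refine (intervalIntegral.norm_integral_le_of_norm_le_const (C := M * C) fun s hs => ?_).trans_eq
    (by rw [sub_zero, abs_of_nonneg ht])
  rw [uIoc_of_le ht] at hs
  refine ((S _).le_opNorm _).trans
    (mul_le_mul (hM _ ?_) (hf s ⟨hs.1.le, hs.2⟩) (norm_nonneg _) hM0)
  exact Real.toNNReal_le_toNNReal (by linarith [hs.1])

variable [CompleteSpace X]

theorem intervalIntegrable_apply_sub {f : ℝ → X} {t : ℝ} (ht : 0 ≤ t)
    (hf : IsBoundedMeasurable f t) (d : ℝ) :
    IntervalIntegrable (fun s => S (d - s).toNNReal (f s)) volume 0 t := by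
  rw [intervalIntegrable_iff_integrableOn_Icc_of_le ht]
  obtain ⟨C, hC⟩ := hf.bounded
  obtain ⟨M, hM0, hM⟩ := S.exists_norm_le d.toNNReal
  refine IntegrableOn.of_bound (C := M * C) measure_Icc_lt_top ?_ ?_
  · have h1 : AEStronglyMeasurable (fun s : ℝ => (d - s).toNNReal) (volume.restrict (Icc 0 t)) :=
      (continuous_real_toNNReal.comp (continuous_sub_left d)).aestronglyMeasurable
    exact S.continuous_uncurry.comp_aestronglyMeasurable (h1.prodMk hf.1)
  · filter_upwards [ae_restrict_mem measurableSet_Icc] with s hs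
    refine ((S _).le_opNorm _).trans (mul_le_mul (hM _ ?_) (hC s hs) (norm_nonneg _) hM0)
    exact Real.toNNReal_le_toNNReal (by linarith [hs.1])

theorem apply_convolution {f : ℝ → X} {t r : ℝ} (ht : 0 ≤ t) (hr : 0 ≤ r)
    (hf : IsBoundedMeasurable f t) :
    S r.toNNReal (S.convolution f t) = ∫ s in (0 : ℝ)..t, S (r + t - s).toNNReal (f s) := by
  rw [convolution, ← ContinuousLinearMap.intervalIntegral_comp_comm _
    (S.intervalIntegrable_apply_sub ht hf t)]
  refine intervalIntegral.integral_congr fun s hs => ?_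
  rw [uIcc_of_le ht] at hs
  simp only [apply_apply]
  rw [← Real.toNNReal_add hr (sub_nonneg.2 hs.2), add_sub_assoc]

/-- The bounded operator `A₋₁` intertwines the two semigroups and so leaves the integral. -/
theorem integral_extrapolation_eq (lam : S.resolventSet) {f : ℝ → X} {t : ℝ} (ht : 0 ≤ t)
    (hf : IsBoundedMeasurable f t) :
    ∫ s in (0 : ℝ)..t, S.extrapolation lam (t - s).toNNReal (S.extrapolatedGenerator lam (f s)) =
      S.extrapolatedGenerator lam (S.convolution f t) := by
  rw [convolution, ← ContinuousLinearMap.intervalIntegral_comp_comm _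
    (S.intervalIntegrable_apply_sub ht hf t)]
  simp only [extrapolation_extrapolatedGenerator]

/-- The integral is split at `a`: the state reached at time `a` evolves freely for time `b`, and the
later input acts as if started at time zero. This is the tool for changing the length of the
interval. -/
theorem convolution_add {f : ℝ → X} {a b : ℝ} (ha : 0 ≤ a) (hb : 0 ≤ b)
    (hf : IsBoundedMeasurable f (a + b)) :
    S.convolution f (a + b) =
      S b.toNNReal (S.convolution f a) + S.convolution (fun s => f (s + a)) b := by
  have hi := S.intervalIntegrable_apply_sub (add_nonneg ha hb) hf (a + b)
  have hsub : ∀ c ∈ Icc 0 (a + b), ∀ d ∈ Icc 0 (a + b),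
      IntervalIntegrable (fun s => S (a + b - s).toNNReal (f s)) volume c d := fun c hc d hd =>
    hi.mono_set (by
      rw [uIcc_of_le (add_nonneg ha hb)]
      exact uIcc_subset_Icc hc hd)
  rw [S.apply_convolution ha hb (hf.mono (by linarith)), convolution,
    ← intervalIntegral.integral_add_adjacent_intervals (b := a)
      (hsub _ ⟨le_rfl, by positivity⟩ _ ⟨ha, by linarith⟩)
      (hsub _ ⟨ha, by linarith⟩ _ ⟨by positivity, le_rfl⟩)]
  congr 1
  · simp only [add_comm]
  · have := intervalIntegral.integral_comp_add_right
      (fun s => S (a + b - s).toNNReal (f s)) a (a := 0) (b := b)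
    rw [zero_add, add_comm b a] at this
    rw [← this, convolution]
    refine intervalIntegral.integral_congr fun s _ => ?_
    congr 3
    ring

/-- The source of the semivariation sums: each constant piece of an input contributes one increment
of the semigroup. -/
theorem hasGenerator_integral_apply_sub {a b t : ℝ} (hab : a ≤ b) (hb : b ≤ t) (c : X) :
    S.HasGenerator (∫ s in a..b, S (t - s).toNNReal c)
      (S (t - a).toNNReal c - S (t - b).toNNReal c) := by
  rw [intervalIntegral.integral_comp_sub_left (fun s : ℝ => S s.toNNReal c) t]
  exact S.hasGenerator_integral (by linarith) (by linarith) c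

/-- The semivariation bounds the map `g ↦ A (S ∗ g)(t)` on step functions. -/
theorem exists_hasGenerator_convolution_step {t τ ε : ℝ} (ht : 0 ≤ t) (htτ : t ≤ τ) (hε : 0 < ε)
    (hS : S.semivariation τ.toNNReal < ∞) {g : ℝ → X} (hg : IsStepFunction g)
    (hgε : ∀ s ∈ Icc 0 t, ‖g s‖ ≤ ε) :
    ∃ y, S.HasGenerator (S.convolution g t) y ∧
      ‖y‖ ≤ (S.semivariation τ.toNNReal).toReal * ε := by
  -- Induction along the partition. Under `s ↦ t - s` the points already treated partition `[t - b,
  -- τ]`, so a growing `b` adds points at the front.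
  have key : ∀ b, Relation.ReflTransGen
      (fun a b => a < b ∧ ∃ c, ‖c‖ ≤ ε ∧ ∀ s ∈ Ioo a b, g s = c) 0 b → b ≤ t → 0 ≤ b ∧
      ∃ (n : ℕ) (p : Fin (n + 1) → ℝ≥0) (x : Fin n → X), StrictMono p ∧ p 0 = (t - b).toNNReal ∧
        p (Fin.last n) = τ.toNNReal ∧ (∀ i, ‖x i‖ ≤ ε) ∧
        S.HasGenerator (∫ s in (0 : ℝ)..b, S (t - s).toNNReal (g s))
          (∑ i : Fin n, (S (p i.castSucc) - S (p i.succ)) (x i)) := by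
    intro b hb
    induction hb with
    | refl =>
      refine fun _ => ⟨le_rfl, ?_⟩
      -- When `t < τ`, the interval `[t, τ]` with the vector `0` pads the partition, so that the
      -- semivariation on `[0, τ]` serves every `t ≤ τ`.
      rcases htτ.eq_or_lt with h | h
      · exact ⟨0, fun _ => τ.toNNReal, Fin.elim0, Subsingleton.strictMono (α := Fin 1) _, by simp [h], rfl,
          fun i => i.elim0, by simpa using S.hasGenerator_zero⟩
      · refine ⟨1, ![t.toNNReal, τ.toNNReal], fun _ => 0, ?_, by simp, by simp,
          fun _ => by simpa using hε.le, by simpa using S.hasGenerator_zero⟩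
        refine Fin.strictMono_iff_lt_succ.2 fun i => ?_
        have hlt := (Real.toNNReal_lt_toNNReal_iff (ht.trans_lt h)).2 h
        fin_cases i
        simpa using hlt
    | tail _ hab ih =>
      rename_i a b _
      obtain ⟨hab, c, hc, hgc⟩ := hab
      intro hbt
      obtain ⟨ha, n, p, x, hp, hp0, hpl, hx, hA⟩ := ih (hab.le.trans hbt)
      have hb0 := ha.trans hab.le
      -- The sign in `-c` matches `S(t - a) c - S(t - b) c` with the order of the points `t - b < t
      -- - a`.
      refine ⟨hb0, n + 1, Fin.cons (t - b).toNNReal p, Fin.cons (-c) x, ?_, rfl, ?_, ?_, ?_⟩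
      · refine Fin.strictMono_iff_lt_succ.2 fun i => ?_
        refine Fin.cases ?_ (fun j => ?_) i
        · simp only [Fin.castSucc_zero, Fin.cons_zero, Fin.cons_succ, hp0]
          exact (Real.toNNReal_lt_toNNReal_iff (by linarith)).2 (by linarith)
        · rw [← Fin.succ_castSucc, Fin.cons_succ, Fin.cons_succ]
          exact hp Fin.castSucc_lt_succ
      · rw [← Fin.succ_last, Fin.cons_succ, hpl]
      · refine Fin.cases ?_ (fun j => ?_)
        · simpa using hc
        · simpa using hx j
      · have hi := S.intervalIntegrable_apply_sub hb0 (hg.isBoundedMeasurable b) t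
        have hia := S.intervalIntegrable_apply_sub ha (hg.isBoundedMeasurable a) t
        rw [← intervalIntegral.integral_add_adjacent_intervals hia (hia.symm.trans hi),
          S.integral_apply_sub_congr hab.le hgc, Fin.sum_univ_succ]
        simp only [Fin.castSucc_zero, Fin.cons_zero, Fin.cons_succ, ← Fin.succ_castSucc, hp0]
        rw [add_comm]
        refine HasGenerator.add ?_ hA
        have := S.hasGenerator_integral_apply_sub hab.le hbt c
        simpa [neg_add_eq_sub] using this
  obtain ⟨-, n, p, x, hp, hp0, hpl, hx, hA⟩ := key t (hg.reflTransGen ht hgε) le_rfl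
  exact ⟨_, hA, S.norm_sum_le_semivariation hS hp (by simpa using hp0) hpl hε hx⟩

/-- For step functions `g` the function `A (S ∗ g)` is continuous. -/
theorem exists_continuous_hasGenerator_convolution_step {τ : ℝ} (hτ : 0 ≤ τ) {g : ℝ → X}
    (hg : IsStepFunction g) :
    ∃ Y : ℝ → X, Continuous Y ∧ ∀ t ∈ Icc 0 τ, S.HasGenerator (S.convolution g t) (Y t) := by
  obtain ⟨C, hC⟩ := hg.bounded
  -- The integral is cut off at `min b t` so that one formula covers all `t`: the piece over `(a,
  -- b)` contributes nothing while `t ≤ a` and a continuous function of `t` in general.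
  have key : ∀ b, Relation.ReflTransGen
      (fun a b => a < b ∧ ∃ c, ‖c‖ ≤ C ∧ ∀ s ∈ Ioo a b, g s = c) 0 b → 0 ≤ b ∧
      ∃ Y : ℝ → X, Continuous Y ∧ ∀ t, 0 ≤ t →
        S.HasGenerator (∫ s in (0 : ℝ)..min b t, S (t - s).toNNReal (g s)) (Y t) := by
    intro b hb
    induction hb with
    | refl =>
      refine ⟨le_rfl, fun _ => 0, continuous_const, fun t ht => ?_⟩
      rw [min_eq_left ht, intervalIntegral.integral_same]
      exact S.hasGenerator_zero
    | tail _ hab ih =>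
      rename_i a b _
      obtain ⟨hab, c, -, hgc⟩ := hab
      obtain ⟨ha, Y, hY, hA⟩ := ih
      have hb0 := ha.trans hab.le
      refine ⟨hb0, fun t => Y t + (S (t - min a t).toNNReal c - S (t - min b t).toNNReal c),
        ?_, fun t ht => ?_⟩
      · have h := S.continuous_orbit c
        exact hY.add ((h.comp (by fun_prop : Continuous fun t => t - min a t)).sub
          (h.comp (by fun_prop : Continuous fun t => t - min b t)))
      · have hmin := min_le_min_right t hab.le
        have hi := S.intervalIntegrable_apply_sub (le_min hb0 ht) (hg.isBoundedMeasurable _) t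
        have hia := S.intervalIntegrable_apply_sub (le_min ha ht) (hg.isBoundedMeasurable _) t
        rw [← intervalIntegral.integral_add_adjacent_intervals hia (hia.symm.trans hi),
          S.integral_apply_sub_congr (c := c) hmin]
        · exact (hA t ht).add (S.hasGenerator_integral_apply_sub hmin (min_le_right _ _) c)
        · intro s hs
          refine hgc s ⟨?_, hs.2.trans_le (min_le_left _ _)⟩
          exact (min_lt_iff.1 hs.1).resolve_right (not_lt.2 (hs.2.le.trans (min_le_right _ _)))
  obtain ⟨-, Y, hY, hA⟩ := key τ (hg.reflTransGen hτ fun s _ => hC s)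
  refine ⟨Y, hY, fun t ht => ?_⟩
  have := hA t ht.1
  rwa [min_eq_right ht.2] at this

theorem convolution_sub {f g : ℝ → X} {t : ℝ} (ht : 0 ≤ t) (hf : IsBoundedMeasurable f t)
    (hg : IsBoundedMeasurable g t) :
    S.convolution (fun s => f s - g s) t = S.convolution f t - S.convolution g t := by
  simp only [convolution, map_sub]
  exact intervalIntegral.integral_sub (S.intervalIntegrable_apply_sub ht hf t)
    (S.intervalIntegrable_apply_sub ht hg t)

theorem tendsto_convolution {f : ℝ → X} {g : ℕ → ℝ → X} {t : ℝ} (ht : 0 ≤ t)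
    (hf : IsBoundedMeasurable f t) (hg : ∀ n, IsBoundedMeasurable (g n) t) {ε : ℕ → ℝ}
    (hε : Tendsto ε atTop (𝓝 0)) (h : ∀ n, ∀ s ∈ Icc 0 t, ‖f s - g n s‖ ≤ ε n) :
    Tendsto (fun n => S.convolution (g n) t) atTop (𝓝 (S.convolution f t)) := by
  obtain ⟨M, hM0, hM⟩ := S.exists_norm_le t.toNNReal
  rw [tendsto_iff_norm_sub_tendsto_zero]
  have h0 : Tendsto (fun n => M * ε n * t) atTop (𝓝 0) := by
    simpa using (hε.const_mul M).mul_const t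
  refine squeeze_zero (fun _ => norm_nonneg _) (fun n => ?_) h0
  rw [norm_sub_rev, ← S.convolution_sub ht hf (hg n)]
  exact S.norm_convolution_le ht hM (h n)

/-- If `S` has finite semivariation on `[0, τ]`, then `A (S ∗ f)` is continuous for all regulated
functions `f`. -/
theorem exists_continuousOn_hasGenerator_convolution {τ : ℝ} (hτ : 0 ≤ τ)
    (hS : S.semivariation τ.toNNReal < ∞) {f : ℝ → X} (hf : f ∈ regulatedFunctions X τ) :
    ∃ Y : ℝ → X, ContinuousOn Y (Icc 0 τ) ∧
      ∀ t ∈ Icc 0 τ, S.HasGenerator (S.convolution f t) (Y t) := by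
  set K := (S.semivariation τ.toNNReal).toReal
  have hK : 0 ≤ K := ENNReal.toReal_nonneg
  have hfb := isBoundedMeasurable_of_regulated hτ hf
  choose g hg hfg using fun n : ℕ => exists_isStepFunction_norm_sub_le hτ hf
    (by positivity : 0 < 1 / ((n : ℝ) + 1))
  choose Y hY hA using fun n => S.exists_continuous_hasGenerator_convolution_step hτ (hg n)
  have hε := tendsto_one_div_add_atTop_nhds_zero_nat (𝕜 := ℝ)
  -- The difference of two approximants is again a step function, so the semivariation bounds it
  -- with a constant independent of `t`; this makes the sequence uniformly Cauchy.
  have hdiff : ∀ m n, ∀ t ∈ Icc 0 τ,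
      ‖Y m t - Y n t‖ ≤ K * (1 / ((m : ℝ) + 1) + 1 / ((n : ℝ) + 1)) := by
    intro m n t ht
    obtain ⟨y, hy, hyK⟩ := S.exists_hasGenerator_convolution_step ht.1 ht.2
      (by positivity : 0 < 1 / ((m : ℝ) + 1) + 1 / ((n : ℝ) + 1)) hS ((hg m).sub (hg n))
      fun s hs => by
        have hs' : s ∈ Icc 0 τ := ⟨hs.1, hs.2.trans ht.2⟩
        have e : g m s - g n s = (f s - g n s) - (f s - g m s) := by abel
        rw [e, add_comm]
        exact (norm_sub_le _ _).trans (add_le_add (hfg n s hs') (hfg m s hs'))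
    rw [S.convolution_sub ht.1 ((hg m).isBoundedMeasurable t) ((hg n).isBoundedMeasurable t)] at hy
    rwa [((hA m t ht).sub (hA n t ht)).unique hy]
  have hcau : UniformCauchySeqOn Y atTop (Icc 0 τ) := by
    rw [Metric.uniformCauchySeqOn_iff]
    intro δ hδ
    have h2 : Tendsto (fun n : ℕ => K * (1 / ((n : ℝ) + 1) + 1 / ((n : ℝ) + 1))) atTop (𝓝 0) := by
      simpa using (hε.add hε).const_mul K
    obtain ⟨N, hN⟩ := (h2.eventually (gt_mem_nhds hδ)).exists
    refine ⟨N, fun m hm n hn t ht => ?_⟩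
    rw [dist_eq_norm]
    refine (hdiff m n t ht).trans_lt (lt_of_le_of_lt ?_ hN)
    gcongr
  have hlim : ∀ t, ∃ y, t ∈ Icc 0 τ → Tendsto (fun n => Y n t) atTop (𝓝 y) := fun t => by
    by_cases ht : t ∈ Icc 0 τ
    · obtain ⟨y, hy⟩ := cauchySeq_tendsto_of_complete (hcau.cauchySeq ht)
      exact ⟨y, fun _ => hy⟩
    · exact ⟨0, fun h => absurd h ht⟩
  choose Z hZ using hlim
  refine ⟨Z, (hcau.tendstoUniformlyOn_of_tendsto hZ).continuousOn
    (Frequently.of_forall fun n => (hY n).continuousOn), fun t ht => ?_⟩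
  refine hasGenerator_of_tendsto (S.tendsto_convolution ht.1 (hfb.mono ht.2)
    (fun n => (hg n).isBoundedMeasurable t) hε fun n s hs => hfg n s ⟨hs.1, hs.2.trans ht.2⟩)
    (hZ t ht) (Eventually.of_forall fun n => hA n t ht)

end convolution

end C0Semigroup

/-! ### Continuous approximation of indicators of intervals -/

section tent

/-- A continuous function vanishing outside `(a, b)`, with values in `[0, 1]` and tending to `1`
on `(a, b)` as `n → ∞`. -/
def tent (n : ℕ) (a b s : ℝ) : ℝ := max 0 (min 1 (n * min (s - a) (b - s)))

theorem continuous_tent (n : ℕ) (a b : ℝ) : Continuous (tent n a b) := by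
  unfold tent
  fun_prop

theorem tent_nonneg (n : ℕ) (a b s : ℝ) : 0 ≤ tent n a b s := le_max_left _ _

theorem tent_le_one (n : ℕ) (a b s : ℝ) : tent n a b s ≤ 1 :=
  max_le zero_le_one (min_le_left _ _)

theorem tent_eq_zero (n : ℕ) {a b s : ℝ} (h : s ∉ Ioo a b) : tent n a b s = 0 := by
  refine max_eq_left ((min_le_right _ _).trans (mul_nonpos_of_nonneg_of_nonpos (Nat.cast_nonneg n) ?_))
  by_contra! h'
  obtain ⟨h1, h2⟩ := lt_min_iff.1 h'
  exact h ⟨sub_pos.1 h1, sub_pos.1 h2⟩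

theorem tendsto_tent (a b s : ℝ) :
    Tendsto (fun n => tent n a b s) atTop (𝓝 ((Ioo a b).indicator 1 s)) := by
  by_cases h : s ∈ Ioo a b
  · rw [indicator_of_mem h, Pi.one_apply]
    have hm : 0 < min (s - a) (b - s) := lt_min (sub_pos.2 h.1) (sub_pos.2 h.2)
    refine tendsto_const_nhds.congr' ?_
    filter_upwards [(tendsto_natCast_atTop_atTop.atTop_mul_const hm).eventually_ge_atTop 1]
      with n hn
    rw [tent, min_eq_left hn, max_eq_right zero_le_one]
  · rw [indicator_of_notMem h]
    exact tendsto_const_nhds.congr fun n => (tent_eq_zero n h).symm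

end tent

namespace C0Semigroup

/-! ### From maximal regularity and admissibility to bounded semivariation -/

section admissible

variable {X : Type*} [NormedAddCommGroup X] [NormedSpace ℂ X] {S : C0Semigroup X}

theorem convolution_congr (S : C0Semigroup X) {f g : ℝ → X} {t : ℝ} (ht : 0 ≤ t) (h : ∀ s ∈ Icc 0 t, f s = g s) :
    S.convolution f t = S.convolution g t := by
  refine intervalIntegral.integral_congr fun s hs => ?_
  rw [uIcc_of_le ht] at hs
  simp only [h s hs]

theorem HasGenerator.sum {ι : Type*} (s : Finset ι) {x y : ι → X}
    (h : ∀ i ∈ s, S.HasGenerator (x i) (y i)) :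
    S.HasGenerator (∑ i ∈ s, x i) (∑ i ∈ s, y i) := by
  classical
  induction s using Finset.induction_on with
  | empty => simpa using S.hasGenerator_zero
  | insert i s hi ih =>
    rw [Finset.sum_insert hi, Finset.sum_insert hi]
    exact (h i (Finset.mem_insert_self _ _)).add
      (ih fun j hj => h j (Finset.mem_insert_of_mem hj))

variable [CompleteSpace X]

/-- Removes the extrapolation space from the problem, with the same `τ` on both sides. -/
theorem admissible_extrapolatedGenerator_iff (lam : S.resolventSet) {F : ℝ → Set (ℝ → X)}
    (hF : ∀ τ, F τ ⊆ regulatedFunctions X τ) :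
    S.Admissible lam F (S.extrapolatedGenerator lam) ↔
      ∃ τ : ℝ, 0 < τ ∧ ∀ u ∈ F τ, S.convolution u τ ∈ S.generator.domain := by
  refine exists_congr fun τ => and_congr_right fun hτ => forall₂_congr fun u hu => ?_
  rw [S.integral_extrapolation_eq lam hτ.le (isBoundedMeasurable_of_regulated hτ.le (hF τ hu))]
  simp only [extrapolatedGenerator_eq_iff, mem_domain_iff]

/-- Almost every `t` is good, but the endpoint `τ` need not be. As `t → τ` from the left, `S(τ - t)
(S ∗ u)(t)` tends to `(S ∗ u)(τ)`, and its image `S(τ - t) g(t)` under `A` tends to the left limit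
of `g` at `τ`; closedness of `A` concludes. -/
theorem MaximalRegularity.exists_convolution_mem_domain {F : ℝ → Set (ℝ → X)}
    (hF : ∀ τ, F τ ⊆ regulatedFunctions X τ) (h : S.MaximalRegularity F) :
    ∃ τ : ℝ, 0 < τ ∧ ∀ u ∈ F τ, S.convolution u τ ∈ S.generator.domain := by
  obtain ⟨τ, hτ, h⟩ := h
  refine ⟨τ, hτ, fun u hu => ?_⟩
  obtain ⟨g, hg, hug⟩ := h u hu
  have hub := isBoundedMeasurable_of_regulated hτ.le (hF τ hu)
  obtain ⟨y, hy⟩ := (hF τ hg).2 τ ⟨hτ, le_rfl⟩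
  rw [ae_restrict_iff' measurableSet_Ioo] at hug
  set N : Set ℝ := {t | t ∈ Ioo 0 τ →
    ∃ h : S.convolution u t ∈ S.generator.domain, S.generator ⟨S.convolution u t, h⟩ = g t}
  have hN : Dense N := Measure.dense_of_ae hug
  -- The limit is taken along good times only; they are dense, so the filter is nontrivial.
  have hne : (𝓝[<] τ ⊓ 𝓟 N).NeBot := by
    rw [inf_principal_neBot_iff]
    intro U hU
    obtain ⟨a, ha, hU⟩ := (mem_nhdsLT_iff_exists_Ioo_subset).1 hU
    obtain ⟨t, ht, htN⟩ := hN.inter_open_nonempty (Ioo a τ) isOpen_Ioo (nonempty_Ioo.2 ha)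
    exact ⟨t, hU ht, htN⟩
  have hl : 𝓝[<] τ ⊓ 𝓟 N ≤ 𝓝[<] τ := inf_le_left
  have hIoo : ∀ᶠ t in 𝓝[<] τ, t ∈ Ioo 0 τ := Ioo_mem_nhdsLT hτ
  have hr : Tendsto (fun t : ℝ => (τ - t).toNNReal) (𝓝[<] τ) (𝓝 0) := by
    have : Continuous fun t : ℝ => (τ - t).toNNReal := by fun_prop
    simpa using (this.tendsto τ).mono_left nhdsWithin_le_nhds
  have h1 : Tendsto (fun t => S (τ - t).toNNReal (S.convolution u t)) (𝓝[<] τ)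
      (𝓝 (S.convolution u τ)) := by
    have hc := intervalIntegral.continuousOn_primitive_interval'
      (S.intervalIntegrable_apply_sub hτ.le hub τ) left_mem_uIcc
    rw [uIcc_of_le hτ.le] at hc
    refine ((hc τ ⟨hτ.le, le_rfl⟩).mono_left (nhdsWithin_le_of_mem ?_)).congr' ?_
    · exact mem_of_superset hIoo Ioo_subset_Icc_self
    · filter_upwards [hIoo] with t ht
      rw [S.apply_convolution ht.1.le (sub_nonneg.2 ht.2.le) (hub.mono ht.2.le), sub_add_cancel]
  have h2 : Tendsto (fun t => S (τ - t).toNNReal (g t)) (𝓝[<] τ) (𝓝 y) := by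
    have := (S.continuous_uncurry.tendsto (0, y)).comp (hr.prodMk_nhds hy)
    rwa [apply_zero] at this
  refine (hasGenerator_of_tendsto (h1.mono_left hl) (h2.mono_left hl) ?_).mem_domain
  filter_upwards [hl hIoo, mem_inf_of_right (mem_principal_self N)] with t ht htN
  obtain ⟨hd, e⟩ := htN ht
  have := S.hasGenerator_generator ⟨_, hd⟩
  rw [e] at this
  exact this.map_semigroup _

theorem convolution_mem_domain_add {a b : ℝ} (ha : 0 ≤ a) (hb : 0 ≤ b)
    (hA : ∀ u ∈ continuousFunctions X a, S.convolution u a ∈ S.generator.domain)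
    (hB : ∀ u ∈ continuousFunctions X b, S.convolution u b ∈ S.generator.domain) :
    ∀ u ∈ continuousFunctions X (a + b), S.convolution u (a + b) ∈ S.generator.domain := by
  intro u hu
  rw [S.convolution_add ha hb (isBoundedMeasurable_of_continuousOn (add_nonneg ha hb) hu)]
  refine S.generator.domain.add_mem ?_ (hB _ ?_)
  · obtain ⟨y, hy⟩ := hA u (hu.mono (Icc_subset_Icc_right (by linarith)))
    exact (hy.map_semigroup _).mem_domain
  · exact hu.comp (by fun_prop) fun s hs => ⟨by linarith [hs.1], by linarith [hs.2]⟩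

/-- The input is delayed by `τ - a` and preceded by the constant `u 0`, which keeps it continuous,
as extension by zero would not. The constant part contributes an element of `D(A)` in any case. -/
theorem convolution_mem_domain_of_le {a τ : ℝ} (ha : 0 ≤ a) (haτ : a ≤ τ)
    (h : ∀ u ∈ continuousFunctions X τ, S.convolution u τ ∈ S.generator.domain) :
    ∀ u ∈ continuousFunctions X a, S.convolution u a ∈ S.generator.domain := by
  intro u hu
  set v : ℝ → X := fun s => u (max 0 (s - (τ - a)))
  have hv : ContinuousOn v (Icc 0 τ) := hu.comp (by fun_prop) fun s hs =>
    ⟨le_max_left _ _, max_le ha (by linarith [hs.2])⟩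
  have hd : 0 ≤ τ - a := sub_nonneg.2 haτ
  have hτ : 0 ≤ τ := ha.trans haτ
  have h1 := h v hv
  have e := S.convolution_add hd ha (f := v)
    (by rw [sub_add_cancel]; exact isBoundedMeasurable_of_continuousOn hτ hv)
  rw [sub_add_cancel] at e
  have e1 : S.convolution v (τ - a) = S.convolution (fun _ => u 0) (τ - a) :=
    S.convolution_congr hd fun s hs => by simp only [v, max_eq_left (sub_nonpos.2 hs.2)]
  have e2 : S.convolution (fun s => v (s + (τ - a))) a = S.convolution u a :=
    S.convolution_congr ha fun s hs => by simp only [v, add_sub_cancel_right, max_eq_right hs.1]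
  rw [e1, e2] at e
  rw [e] at h1
  refine (S.generator.domain.add_mem_iff_right ?_).1 h1
  have := S.hasGenerator_integral_apply_sub hd le_rfl (u 0)
  exact (this.map_semigroup _).mem_domain

/-- Admissibility concerns one interval, bounded semivariation all of them: multiples of `τ` are
reached by concatenation, and smaller times by restriction. -/
theorem forall_convolution_mem_domain {τ : ℝ} (hτ : 0 < τ)
    (h : ∀ u ∈ continuousFunctions X τ, S.convolution u τ ∈ S.generator.domain)
    {t : ℝ} (ht : 0 ≤ t) :
    ∀ u ∈ continuousFunctions X t, S.convolution u t ∈ S.generator.domain := by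
  have hn : ∀ n : ℕ, ∀ u ∈ continuousFunctions X (n * τ),
      S.convolution u (n * τ) ∈ S.generator.domain := by
    intro n
    induction n with
    | zero =>
      intro u _
      simp only [Nat.cast_zero, zero_mul, convolution, intervalIntegral.integral_same]
      exact S.generator.domain.zero_mem
    | succ n ih =>
      rw [Nat.cast_succ, add_one_mul]
      exact convolution_mem_domain_add (by positivity) hτ.le ih h
  obtain ⟨n, hnt⟩ := exists_nat_ge (t / τ)
  exact convolution_mem_domain_of_le ht ((div_le_iff₀ hτ).1 hnt) (hn n)

open scoped BoundedContinuousFunction in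
/-- Boundedness of the input map, by the closed graph theorem. -/
theorem exists_norm_generator_convolution_le {τ : ℝ} (hτ : 0 ≤ τ)
    (h : ∀ u ∈ continuousFunctions X τ, S.convolution u τ ∈ S.generator.domain) :
    ∃ K, ∀ u : ℝ → X, Continuous u → (∀ s, ‖u s‖ ≤ 1) →
      ∃ y, S.HasGenerator (S.convolution u τ) y ∧ ‖y‖ ≤ K := by
  have hb : ∀ u : ℝ →ᵇ X, IsBoundedMeasurable u τ := fun u =>
    isBoundedMeasurable_of_continuousOn hτ u.continuous.continuousOn
  have hg : ∀ u : ℝ →ᵇ X, ∃ y, S.HasGenerator (S.convolution u τ) y := fun u =>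
    h u u.continuous.continuousOn
  choose L hL using hg
  let T : (ℝ →ᵇ X) →ₗ[ℂ] X :=
    { toFun := L
      map_add' := fun u v => by
        refine (hL (u + v)).unique ?_
        have e : S.convolution (u + v : ℝ →ᵇ X) τ = S.convolution u τ + S.convolution v τ := by
          simp only [convolution, BoundedContinuousFunction.add_apply, _root_.map_add]
          exact intervalIntegral.integral_add (S.intervalIntegrable_apply_sub hτ (hb u) τ)
            (S.intervalIntegrable_apply_sub hτ (hb v) τ)
        rw [e]
        exact (hL u).add (hL v)
      map_smul' := fun c u => by
        refine (hL (c • u)).unique ?_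
        have e : S.convolution (c • u : ℝ →ᵇ X) τ = c • S.convolution u τ := by
          simp only [convolution, BoundedContinuousFunction.coe_smul, map_smul]
          exact intervalIntegral.integral_smul _ _
        rw [e]
        exact (hL u).smul c }
  -- The graph is closed because uniform convergence of inputs gives convergence of the
  -- convolutions, and `A` is closed.
  have hT : Continuous T := by
    refine LinearMap.continuous_of_seq_closed_graph T fun u v y hu hy => ?_
    refine (hasGenerator_of_tendsto (S.tendsto_convolution hτ (hb v) (fun n => hb (u n))
      (ε := fun n => ‖v - u n‖) ?_ fun n s _ => (v - u n).norm_coe_le_norm s) hy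
      (Eventually.of_forall fun n => hL (u n))).unique (hL v)
    simpa using ((tendsto_const_nhds (x := v)).sub hu).norm
  let T' : (ℝ →ᵇ X) →L[ℂ] X := ⟨T, hT⟩
  refine ⟨‖T'‖, fun u hu hu1 => ?_⟩
  let v : ℝ →ᵇ X := BoundedContinuousFunction.ofNormedAddCommGroup u hu 1 hu1
  refine ⟨L v, hL v, ?_⟩
  have hv : ‖v‖ ≤ 1 := BoundedContinuousFunction.norm_ofNormedAddCommGroup_le hu zero_le_one hu1
  exact (T'.le_of_opNorm_le_of_le le_rfl hv).trans_eq (mul_one _)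

/-- Needed because continuous functions approximate a discontinuous step function only pointwise and
boundedly, not uniformly. -/
theorem tendsto_convolution_of_dominated {f : ℝ → X} {g : ℕ → ℝ → X} {t : ℝ} (ht : 0 ≤ t)
    (hg : ∀ n, Continuous (g n)) {C : ℝ} (hC : ∀ n s, ‖g n s‖ ≤ C)
    (h : ∀ s, Tendsto (fun n => g n s) atTop (𝓝 (f s))) :
    Tendsto (fun n => S.convolution (g n) t) atTop (𝓝 (S.convolution f t)) := by
  obtain ⟨M, hM0, hM⟩ := S.exists_norm_le t.toNNReal
  refine intervalIntegral.tendsto_integral_filter_of_dominated_convergence (fun _ => M * C)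
    (Eventually.of_forall fun n => ?_) (Eventually.of_forall fun n => ?_)
    intervalIntegrable_const ?_
  · have : Continuous fun s : ℝ => S (t - s).toNNReal (g n s) := S.continuous_uncurry.comp
      ((continuous_real_toNNReal.comp (continuous_sub_left t)).prodMk (hg n))
    exact this.aestronglyMeasurable
  · refine Eventually.of_forall fun s hs => ?_
    rw [uIoc_of_le ht] at hs
    refine ((S _).le_opNorm _).trans (mul_le_mul (hM _ ?_) (hC n s) (norm_nonneg _) hM0)
    exact Real.toNNReal_le_toNNReal (by linarith [hs.1])
  · exact Eventually.of_forall fun s _ => ((S _).continuous.tendsto _).comp (h s)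

theorem hasGenerator_convolution_indicator {a b t : ℝ} (ha : 0 ≤ a) (hab : a ≤ b) (hb : b ≤ t)
    (c : X) :
    S.HasGenerator (∫ s in (0 : ℝ)..t, S (t - s).toNNReal ((Ioo a b).indicator (fun _ => c) s))
      (S (t - a).toNNReal c - S (t - b).toNNReal c) := by
  have e : ∫ s in (0 : ℝ)..t, S (t - s).toNNReal ((Ioo a b).indicator (fun _ => c) s) =
      ∫ s in a..b, S (t - s).toNNReal c := by
    have e1 : (fun s => S (t - s).toNNReal ((Ioo a b).indicator (fun _ => c) s)) =
        (Ioo a b).indicator fun s => S (t - s).toNNReal c := by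
      ext s
      by_cases h : s ∈ Ioo a b <;> simp [h]
    rw [intervalIntegral.integral_of_le (ha.trans (hab.trans hb)), e1,
      setIntegral_indicator measurableSet_Ioo, intervalIntegral.integral_of_le hab,
      integral_Ioc_eq_integral_Ioo, inter_eq_right.2]
    exact fun s hs => ⟨ha.trans_lt hs.1, hs.2.le.trans hb⟩
  rw [e]
  exact S.hasGenerator_integral_apply_sub hab hb c

/-- A semivariation sum is, up to sign, `A (S ∗ v)(t)` for a step function `v` with values of norm
at most one. Continuous approximants of `v` obey the closed graph bound `K`, and lower
semicontinuity transfers it to `v` at the cost of the factor `C`. -/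
theorem boundedSemivariation_of_convolution_mem_domain {τ : ℝ} (hτ : 0 < τ)
    (h : ∀ u ∈ continuousFunctions X τ, S.convolution u τ ∈ S.generator.domain) :
    S.BoundedSemivariation := by
  intro t ht
  obtain ⟨K, hK⟩ := exists_norm_generator_convolution_le t.2
    (forall_convolution_mem_domain hτ h t.2)
  obtain ⟨C, -, hC⟩ := S.exists_norm_le 1
  refine lt_of_le_of_lt ?_ (ENNReal.ofReal_lt_top (r := C * K))
  refine iSup_le fun n => iSup_le fun p => iSup_le fun x => iSup_le fun ⟨hp, hp0, hpl, hx⟩ => ?_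
  rw [← ofReal_norm]
  refine ENNReal.ofReal_le_ofReal ?_
  -- Time reversal: `(a i, b i)` is the interval on which the input must equal `x i` to produce the
  -- increment of `S` between `p i.castSucc` and `p i.succ`.
  set a : Fin n → ℝ := fun i => t - p i.succ
  set b : Fin n → ℝ := fun i => t - p i.castSucc
  have hpt : ∀ i, p i ≤ t := fun i => hpl ▸ hp.monotone (Fin.le_last i)
  have ha : ∀ i, 0 ≤ a i := fun i => sub_nonneg.2 (NNReal.coe_le_coe.2 (hpt _))
  have hb : ∀ i, b i ≤ t := fun i => sub_le_self _ (p _).2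
  have hab : ∀ i, a i ≤ b i := fun i =>
    sub_le_sub_left (NNReal.coe_le_coe.2 (hp Fin.castSucc_lt_succ).le) _
  -- Disjointness leaves at most one nonzero tent at each point, so the approximants have norm at
  -- most `1` however fine the partition is.
  have hdisj : ∀ i j s, s ∈ Ioo (a i) (b i) → s ∈ Ioo (a j) (b j) → i = j := by
    have : ∀ i j s, i < j → s ∈ Ioo (a i) (b i) → s ∉ Ioo (a j) (b j) := by
      intro i j s hij hi hj
      have h1 : p i.succ ≤ p j.castSucc := hp.monotone (Fin.succ_le_castSucc_iff.2 hij)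
      have h2 : b j ≤ a i := sub_le_sub_left (NNReal.coe_le_coe.2 h1) _
      exact (hj.2.trans_le h2).not_ge hi.1.le
    intro i j s hi hj
    rcases lt_trichotomy i j with hij | hij | hij
    · exact absurd hj (this i j s hij hi)
    · exact hij
    · exact absurd hi (this j i s hij hj)
  set u : ℕ → ℝ → X := fun m s => ∑ i, tent m (a i) (b i) s • x i
  have huc : ∀ m, Continuous (u m) := fun m =>
    continuous_finsetSum _ fun i _ => (continuous_tent m _ _).smul continuous_const
  have hu1 : ∀ m s, ‖u m s‖ ≤ 1 := fun m s => by
    by_cases hs : ∃ i, s ∈ Ioo (a i) (b i)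
    · obtain ⟨i, hi⟩ := hs
      have : u m s = tent m (a i) (b i) s • x i :=
        Finset.sum_eq_single i (fun j _ hji => by
          rw [tent_eq_zero m fun hj => hji (hdisj j i s hj hi), zero_smul])
          fun hi => absurd (Finset.mem_univ i) hi
      rw [this, norm_smul, Real.norm_of_nonneg (tent_nonneg _ _ _ _)]
      exact mul_le_one₀ (tent_le_one _ _ _ _) (norm_nonneg _) (hx i)
    · push Not at hs
      have : u m s = 0 := Finset.sum_eq_zero fun i _ => by rw [tent_eq_zero m (hs i), zero_smul]
      rw [this, norm_zero]
      exact zero_le_one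
  set v : ℝ → X := fun s => ∑ i, (Ioo (a i) (b i)).indicator (fun _ => x i) s
  have huv : ∀ s, Tendsto (fun m => u m s) atTop (𝓝 (v s)) := fun s =>
    tendsto_finsetSum _ fun i _ => by
      have := (tendsto_tent (a i) (b i) s).smul_const (x i)
      by_cases hs : s ∈ Ioo (a i) (b i) <;> simpa [hs] using this
  have hv : S.HasGenerator (S.convolution v t)
      (∑ i, (S (t - a i).toNNReal (x i) - S (t - b i).toNNReal (x i))) := by
    have hi : ∀ i, IntervalIntegrable
        (fun s => S (t - s).toNNReal ((Ioo (a i) (b i)).indicator (fun _ => x i) s))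
        volume 0 t := fun i => S.intervalIntegrable_apply_sub t.2
      ⟨(stronglyMeasurable_const.indicator measurableSet_Ioo).aestronglyMeasurable,
        ‖x i‖, fun s _ => norm_indicator_le_norm_self _ _⟩ t
    have e : S.convolution v t = ∑ i, ∫ s in (0 : ℝ)..t,
        S (t - s).toNNReal ((Ioo (a i) (b i)).indicator (fun _ => x i) s) := by
      rw [← intervalIntegral.integral_finsetSum fun i _ => hi i]
      simp only [convolution, v, map_sum]
    rw [e]
    exact HasGenerator.sum _ fun i _ =>
      hasGenerator_convolution_indicator (ha i) (hab i) (hb i) (x i)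
  choose y hy hyK using fun m => hK (u m) (huc m) (hu1 m)
  have := hv.norm_le_of_tendsto hC (tendsto_convolution_of_dominated t.2 huc hu1 huv) hy hyK
  rw [← norm_neg, ← Finset.sum_neg_distrib]
  refine (congrArg norm (Finset.sum_congr rfl fun i _ => ?_)).trans_le this
  simp only [a, b, sub_sub_cancel, Real.toNNReal_coe, sub_apply, neg_sub]

end admissible

end C0Semigroup

theorem proposition2p2 {X : Type*} [NormedAddCommGroup X] [NormedSpace ℂ X] [CompleteSpace X]
    (S : C0Semigroup X) (lam : S.resolventSet) :
    List.TFAE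
      [S.MaximalRegularity (continuousFunctions X),
       S.Admissible lam (continuousFunctions X) (S.extrapolatedGenerator lam),
       S.BoundedSemivariation,
       S.MaximalRegularity (regulatedFunctions X),
       S.Admissible lam (regulatedFunctions X) (S.extrapolatedGenerator lam)] := by
  have hC : ∀ τ, continuousFunctions X τ ⊆ regulatedFunctions X τ :=
    continuousFunctions_subset_regulatedFunctions
  have hR : ∀ τ, regulatedFunctions X τ ⊆ regulatedFunctions X τ := fun _ => Subset.rfl
  -- For regulated `f` the function `A (S ∗ f)` is even continuous, so one argument serves every
  -- class between the continuous and the regulated functions.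
  have reg : ∀ F : ℝ → Set (ℝ → X), (∀ τ, F τ ⊆ regulatedFunctions X τ) →
      (∀ τ, continuousFunctions X τ ⊆ F τ) → S.BoundedSemivariation → S.MaximalRegularity F := by
    intro F hF hCF hS
    refine ⟨1, one_pos, fun f hf => ?_⟩
    obtain ⟨Y, hY, hA⟩ := S.exists_continuousOn_hasGenerator_convolution zero_le_one
      (hS _ (Real.toNNReal_pos.2 one_pos)) (hF 1 hf)
    refine ⟨Y, hCF 1 hY, ?_⟩
    filter_upwards [ae_restrict_mem measurableSet_Ioo] with t ht
    have h := hA t (Ioo_subset_Icc_self ht)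
    exact ⟨h.mem_domain, h.generator_eq⟩
  tfae_have 1 → 2 := fun h =>
    (C0Semigroup.admissible_extrapolatedGenerator_iff lam hC).2 (h.exists_convolution_mem_domain hC)
  tfae_have 4 → 5 := fun h =>
    (C0Semigroup.admissible_extrapolatedGenerator_iff lam hR).2 (h.exists_convolution_mem_domain hR)
  tfae_have 5 → 2 := fun ⟨τ, hτ, h⟩ => ⟨τ, hτ, fun u hu => h u (hC τ hu)⟩
  tfae_have 2 → 3 := fun h => by
    obtain ⟨τ, hτ, h⟩ := (C0Semigroup.admissible_extrapolatedGenerator_iff lam hC).1 h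
    exact C0Semigroup.boundedSemivariation_of_convolution_mem_domain hτ h
  tfae_have 3 → 1 := reg _ hC fun _ => Subset.rfl
  tfae_have 3 → 4 := reg _ hR hC
  tfae_finish
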